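/- Let $(\mathcal X,\rho)$ be a separable metric space with its Borel $\sigma$-algebra. Let $\mathcal Y$ be a measurable space with a jointly measurable loss $\ell:\mathcal Y^2\to[0,\infty)$ that is a near-metric, i.e. $\ell(y_1,y_2)=\ell(y_2,y_1)$, $\ell(y_1,y_2)=0$ if and only if $y_1=y_2$, and $\ell(y_1,y_3)\le c_\ell(\ell(y_2,y_1)+\ell(y_2,y_3))$ for all $y_1,y_2,y_3$ and some constant $c_\ell$. Assume that $\ell$ is separable (there is a countable $S\subset\mathcal Y$ such that for all $y\in\mathcal Y$ and $\varepsilon>0$ some $s\in S$ has $\ell(s,y)<\varepsilon$) and bounded ($\sup_{y_1,y_2}\ell(y_1,y_2)<\infty$). A learning rule is a sequence $f_\cdot=(f_t)_{t\ge1}$ of measurable functions $f_t:\mathcal X^{t-1}\times\mathcal Y^{t-1}\times\mathcal X\to\mathcal Y$. For a stochastic process $\mathbb X=(X_t)_{t\ge1}$ on $\mathcal X$ and a measurable $f^*:\mathcal X\to\mathcal Y$, put $Y_t=f^*(X_t)$ and $$\mathcal L_{\mathbb X}(f_\cdot,f^*;T)=\frac1T\sum_{t=1}^T\ell\bigl(f_t((X_u)_{u<t},(Y_u)_{u<t},X_t),\,f^*(X_t)\bigr).$$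 The rule $f_\cdot$ is strongly (resp. weakly) universally consistent under $\mathbb X$ if for every measurable $f^*$, $\mathcal L_{\mathbb X}(f_\cdot,f^*;T)\to0$ almost surely (resp. $\mathbb E\,\mathcal L_{\mathbb X}(f_\cdot,f^*;T)\to0$) as $T\to\infty$. It is strongly (resp. weakly) optimistically universal if it is strongly (resp. weakly) universally consistent under every process $\mathbb X$ under which some learning rule is strongly (resp. weakly) universally consistent. The 2-Capped-1-Nearest-Neighbour rule (2C1NN) predicts a fixed $y_0\in\mathcal Y$ at time $1$ and starts with the dataset of indices $\mathcal D_2=\{1\}$ and count $n_1=0$. At time $t\ge2$: if $X_t=X_u$ for some $u<t$, it predicts $Y_u$ for the first such $u$, and $\mathcal D_{t+1}=\mathcal D_t$. Otherwise it selects $\phi(t)\in\arg\min_{u\in\mathcal D_t}\rho(X_t,X_u)$, predicts $Y_{\phi(t)}$, increases $n_{\phi(t)}$ by one, sets $n_t=0$, and sets $\mathcal D_{t+1}=\mathcal D_t\cup\{t\}$, with $\phi(t)$ removed if now $n_{\phi(t)}=2$. Ties are broken in an arbitrary way that depends measurably on $(X_u)_{u\le t}$ and $\mathcal D_t$ (for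 example by the minimum index). Then 2C1NN is a learning rule, and it is both strongly and weakly optimistically universal. -/

import Mathlib

open MeasureTheory Filter Topology

namespace OnlineLearning

/-- A near-metric loss on `Y`: nonnegative, symmetric, zero exactly on the diagonal, and satisfying
a triangle inequality relaxed by a constant factor. -/
structure IsNearMetric {Y : Type*} (loss : Y → Y → ℝ) : Prop where
  nonneg : ∀ y₁ y₂, 0 ≤ loss y₁ y₂
  symm : ∀ y₁ y₂, loss y₁ y₂ = loss y₂ y₁
  eq_zero_iff : ∀ y₁ y₂, loss y₁ y₂ = 0 ↔ y₁ = y₂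
  relaxed_triangle : ∃ c : ℝ, ∀ y₁ y₂ y₃, loss y₁ y₃ ≤ c * (loss y₂ y₁ + loss y₂ y₃)

/-- Separability of a value space: some countable set is dense with respect to the loss. -/
def IsSeparableLoss {Y : Type*} (loss : Y → Y → ℝ) : Prop :=
  ∃ S : Set Y, S.Countable ∧ ∀ y : Y, ∀ ε : ℝ, 0 < ε → ∃ s ∈ S, loss s y < ε

/-- The loss is bounded. -/
def IsBoundedLoss {Y : Type*} (loss : Y → Y → ℝ) : Prop :=
  ∃ M : ℝ, ∀ y₁ y₂, loss y₁ y₂ ≤ M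

/-- Prediction functions of an online learner. Time starts at `0`, so that at time `t` the history
consists of `t` instances and their `t` values; the last argument is the new instance. -/
abbrev Rule (X Y : Type*) := (t : ℕ) → (Fin t → X) → (Fin t → Y) → X → Y

/-- A learning rule is a sequence of jointly measurable prediction functions. -/
def IsLearningRule {X Y : Type*} [MeasurableSpace X] [MeasurableSpace Y] (f : Rule X Y) : Prop :=
  ∀ t : ℕ, Measurable fun p : (Fin t → X) × (Fin t → Y) × X => f t p.1 p.2.1 p.2.2

/-- Average loss over the first `T` predictions of `f` on the instance sequence `x`, the values
being revealed by the target function `g`. -/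
noncomputable def avgLoss {X Y : Type*} (loss : Y → Y → ℝ) (f : Rule X Y) (g : X → Y)
    (x : ℕ → X) (T : ℕ) : ℝ :=
  (∑ t ∈ Finset.range T,
    loss (f t (fun i : Fin t => x i) (fun i : Fin t => g (x i)) (x t)) (g (x t))) / (T : ℝ)

section Consistency

variable {X Y Ω : Type*} [MeasurableSpace X] [MeasurableSpace Y] [MeasurableSpace Ω]

/-- Strong universal consistency under the process `ξ`: for every measurable target function the
average loss tends to `0` almost surely. -/
def StronglyUniversallyConsistent (loss : Y → Y → ℝ) (P : Measure Ω) (ξ : ℕ → Ω → X)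
    (f : Rule X Y) : Prop :=
  ∀ g : X → Y, Measurable g →
    ∀ᵐ ω ∂P, Tendsto (fun T : ℕ => avgLoss loss f g (fun t => ξ t ω) T) atTop (𝓝 0)

/-- Weak universal consistency under the process `ξ`: for every measurable target function the
expected average loss tends to `0`. -/
def WeaklyUniversallyConsistent (loss : Y → Y → ℝ) (P : Measure Ω) (ξ : ℕ → Ω → X)
    (f : Rule X Y) : Prop :=
  ∀ g : X → Y, Measurable g →
    Tendsto (fun T : ℕ => ∫ ω, avgLoss loss f g (fun t => ξ t ω) T ∂P) atTop (𝓝 0)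

/-- The processes on `(Ω, P)` that admit strong universal online learning. -/
def SUOL (loss : Y → Y → ℝ) (P : Measure Ω) : Set (ℕ → Ω → X) :=
  {ξ | (∀ t, Measurable (ξ t)) ∧
    ∃ f : Rule X Y, IsLearningRule f ∧ StronglyUniversallyConsistent loss P ξ f}

/-- The processes on `(Ω, P)` that admit weak universal online learning. -/
def WUOL (loss : Y → Y → ℝ) (P : Measure Ω) : Set (ℕ → Ω → X) :=
  {ξ | (∀ t, Measurable (ξ t)) ∧
    ∃ f : Rule X Y, IsLearningRule f ∧ WeaklyUniversallyConsistent loss P ξ f}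

end Consistency

universe u v w

/-- A learning rule is strongly optimistically universal if it is strongly universally consistent
under every process for which some learning rule is. -/
def StronglyOptimisticallyUniversal {X : Type u} {Y : Type v} [MeasurableSpace X]
    [MeasurableSpace Y] (loss : Y → Y → ℝ) (f : Rule X Y) : Prop :=
  IsLearningRule f ∧
    ∀ (Ω : Type w) [MeasurableSpace Ω] (P : Measure Ω) [IsProbabilityMeasure P],
      ∀ ξ ∈ (SUOL loss P : Set (ℕ → Ω → X)), StronglyUniversallyConsistent loss P ξ f

/-- A learning rule is weakly optimistically universal if it is weakly universally consistent
under every process for which some learning rule is. -/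
def WeaklyOptimisticallyUniversal {X : Type u} {Y : Type v} [MeasurableSpace X]
    [MeasurableSpace Y] (loss : Y → Y → ℝ) (f : Rule X Y) : Prop :=
  IsLearningRule f ∧
    ∀ (Ω : Type w) [MeasurableSpace Ω] (P : Measure Ω) [IsProbabilityMeasure P],
      ∀ ξ ∈ (WUOL loss P : Set (ℕ → Ω → X)), WeaklyUniversallyConsistent loss P ξ f

section CappedNearestNeighbour

/-- Candidate nearest neighbour selections: from `n + 1` past instances, a new instance and a set
of indices of past instances, pick an index. -/
abbrev Selector (X : Type*) :=
  (n : ℕ) → (Fin (n + 1) → X) → X → Finset (Fin (n + 1)) → Fin (n + 1)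

/-- `sel` picks, from every nonempty index set, a nearest neighbour of the new instance. How ties
are broken is left open, except that it must be measurable in the observed instances. -/
structure IsNearestSelector {X : Type*} [MetricSpace X] [MeasurableSpace X]
    (sel : Selector X) : Prop where
  mem : ∀ (n : ℕ) (x : Fin (n + 1) → X) (z : X) (D : Finset (Fin (n + 1))), D.Nonempty →
    sel n x z D ∈ D
  dist_le : ∀ (n : ℕ) (x : Fin (n + 1) → X) (z : X) (D : Finset (Fin (n + 1))), D.Nonempty →
    ∀ u ∈ D, dist z (x (sel n x z D)) ≤ dist z (x u)
  measurable : ∀ (n : ℕ) (D : Finset (Fin (n + 1))), Measurable fun p : (Fin (n + 1) → X) × X => sel n p.1 p.2 D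

open Classical in
/-- Breaking ties by the smallest index. -/
noncomputable def minIndexSelector (X : Type*) [MetricSpace X] : Selector X := fun _ x z D =>
  if h : (D.filter fun u => ∀ v ∈ D, dist z (x u) ≤ dist z (x v)).Nonempty then
    (D.filter fun u => ∀ v ∈ D, dist z (x u) ≤ dist z (x v)).min' h
  else 0

/-- Breaking ties by the smallest index is an admissible way to select nearest neighbours. -/
theorem isNearestSelector_minIndexSelector (X : Type*) [MetricSpace X]
    [TopologicalSpace.SeparableSpace X] [MeasurableSpace X] [BorelSpace X] :
    IsNearestSelector (minIndexSelector X) := by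
  classical
  have : SecondCountableTopology X := UniformSpace.secondCountable_of_separable X
  have key : ∀ (n : ℕ) (x : Fin (n + 1) → X) (z : X) (D : Finset (Fin (n + 1))), D.Nonempty →
      minIndexSelector X n x z D ∈ D.filter fun u => ∀ v ∈ D, dist z (x u) ≤ dist z (x v) := by
    intro n x z D hD
    obtain ⟨u, hu, huv⟩ := D.exists_min_image (fun u => dist z (x u)) hD
    have h : (D.filter fun u => ∀ v ∈ D, dist z (x u) ≤ dist z (x v)).Nonempty :=
      ⟨u, Finset.mem_filter.2 ⟨hu, huv⟩⟩
    have e : minIndexSelector X n x z D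
        = (D.filter fun u => ∀ v ∈ D, dist z (x u) ≤ dist z (x v)).min' h := by
      unfold minIndexSelector
      exact dif_pos h
    rw [e]
    exact Finset.min'_mem _ h
  refine ⟨fun n x z D hD => (Finset.mem_filter.1 (key n x z D hD)).1,
    fun n x z D hD => (Finset.mem_filter.1 (key n x z D hD)).2, fun n D => ?_⟩
  let c : Finset (Fin (n + 1)) → Fin (n + 1) := fun S => if h : S.Nonempty then S.min' h else 0
  let F : (Fin (n + 1) → X) × X → Finset (Fin (n + 1)) := fun p =>
    D.filter fun u => ∀ v ∈ D, dist p.2 (p.1 u) ≤ dist p.2 (p.1 v)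
  have hF : ∀ S, MeasurableSet {p | F p = S} := by
    intro S
    have hS : {p | F p = S} = ⋂ u, {p | u ∈ F p ↔ u ∈ S} := by
      ext p
      simp [Finset.ext_iff]
    rw [hS]
    refine MeasurableSet.iInter fun u => ?_
    have hu : MeasurableSet {p | u ∈ F p} := by
      have hE : {p | u ∈ F p} = {p | u ∈ D} ∩
          ⋂ v, ⋂ _ : v ∈ D, {p : (Fin (n + 1) → X) × X | dist p.2 (p.1 u) ≤ dist p.2 (p.1 v)} := by
        ext p
        simp [F]
      rw [hE]
      refine (MeasurableSet.const _).inter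
        (MeasurableSet.iInter fun v => MeasurableSet.iInter fun _ => ?_)
      apply measurableSet_le <;> fun_prop
    exact hu.iff (MeasurableSet.const _)
  have hc : (fun p : (Fin (n + 1) → X) × X => minIndexSelector X n p.1 p.2 D)
      = fun p => c (F p) := by
    funext p
    rfl
  rw [hc]
  refine measurable_to_countable' fun i => ?_
  have hi : (fun p => c (F p)) ⁻¹' {i} = ⋃ S ∈ {S | c S = i}, {p | F p = S} := by
    ext p
    simp
  rw [hi]
  exact MeasurableSet.biUnion (Set.to_countable _) fun S _ => hF S

/-- The memory of the capped nearest neighbour rule after `m` instances: the indices in the current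
dataset, and how many times each index has been used as a nearest neighbour. -/
structure Memory (m : ℕ) where
  data : Finset (Fin m)
  count : Fin m → ℕ

open Classical in
/-- One update of the memory with cap `k`, on the new instance `z`. An already visited instance
changes nothing. Otherwise the new index is added, its selected neighbour is charged once, and that
neighbour is removed when its count reaches `k`. -/
noncomputable def updateMemory {X : Type*} (k : ℕ) (sel : Selector X) (n : ℕ)
    (x : Fin (n + 1) → X) (z : X) (s : Memory (n + 1)) : Memory (n + 2) :=
  if ∃ u, x u = z then
    { data := s.data.map Fin.castSuccEmb
      count := Fin.snoc (α := fun _ => ℕ) s.count 0 }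
  else
    let φ := sel n x z s.data
    let D := if s.count φ + 1 = k then s.data.erase φ else s.data
    { data := insert (Fin.last (n + 1)) (D.map Fin.castSuccEmb)
      count := Fin.snoc (α := fun _ => ℕ) (Function.update s.count φ (s.count φ + 1)) 0 }

/-- The memory after processing the `n + 1` instances `x`; the first instance always enters the
dataset. -/
noncomputable def memory {X : Type*} (k : ℕ) (sel : Selector X) :
    (n : ℕ) → (Fin (n + 1) → X) → Memory (n + 1)
  | 0, _ => { data := {0}, count := fun _ => 0 }
  | n + 1, x =>
    updateMemory k sel n (Fin.init x) (x (Fin.last (n + 1))) (memory k sel n (Fin.init x))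

open Classical in
/-- The `k`-capped 1-nearest neighbour rule. The first prediction is `y₀`. If the new instance was
already visited, its (first) recorded value is predicted; otherwise the value of the selected
nearest neighbour within the current dataset is. -/
noncomputable def kC1NN {X Y : Type*} (k : ℕ) (sel : Selector X) (y₀ : Y) : Rule X Y
  | 0, _, _, _ => y₀
  | n + 1, x, y, z =>
    if h : ∃ u, x u = z then y (Fin.find (fun u => x u = z) h)
    else y (sel n x z (memory k sel n x).data)

end CappedNearestNeighbour

end OnlineLearning

/-! Both modes of consistency say that a cumulative loss divided by time vanishes asymptotically,
measured by `strongRate` or by `weakRate`. The argument uses only the properties collected in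
`RateFunctional`, so it is carried out once, for an arbitrary `R`.

Necessity. Label the cells of a countable measurable partition by independent fair coins. Whatever
the rule, the first visit of a cell then costs at least a fixed positive loss on average. A rule
that learns every labelling therefore forces the number of visited cells to be sublinear
(`rate_visits_eq_zero`). A diagonal construction of one partition upgrades this to continuity: along
measurable sets decreasing to the empty set, the rate of newly visited points becomes arbitrarily
small (`exists_rate_newVisits_le`).

Sufficiency. This continuity is all that 2C1NN needs. Join each new point to its selected neighbour
by an edge. Since a point is selected at most twice, the edges meeting a set `C` number at most
three times the new visits of `C`. On the other hand a new point of a region brings two units of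
capacity and uses at most one of them, so a region runs dry only after two selections from outside.
Applied to finitely many separated small cells, this shows that edges longer than `ρ` are at most
half as frequent as edges longer than some smaller length, up to negligible terms
(`two_mul_tally_far_le`). The supremum `S` over `ρ` of these rates thus satisfies `S ≤ S / 2`, and
is zero (`rate_far_eq_zero`).

Short edges rarely cross the boundary of an open set; induction over Borel sets extends this to all
measurable sets (`rate_mistake_eq_zero`), and a countable approximation of the target by values of
the dense set bounds the loss (`rate_cumLoss_kC1NN_eq_zero`). -/

namespace OnlineLearning

/-! ### Rate functionals: a common framework for almost sure and expected frequencies -/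

open scoped ENNReal

/-- An asymptotic size for random counts `n T ω`, normalized by the time `T`: `tail a n` measures the
frequencies `n T / T` at the times `T ≥ a`. -/
structure RateFunctional {Ω : Type*} [MeasurableSpace Ω] (P : Measure Ω) where
  tail : ℕ → (ℕ → Ω → ℝ≥0∞) → ℝ≥0∞
  mono : ∀ a {n m : ℕ → Ω → ℝ≥0∞}, (∀ T ω, n T ω ≤ m T ω) → tail a n ≤ tail a m
  anti : ∀ {a b : ℕ} (n : ℕ → Ω → ℝ≥0∞), a ≤ b → tail b n ≤ tail a n
  add : ∀ a {n m : ℕ → Ω → ℝ≥0∞}, (∀ T, Measurable (n T)) →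
    tail a (fun T ω => n T ω + m T ω) ≤ tail a n + tail a m
  smul : ∀ a {n : ℕ → Ω → ℝ≥0∞} (c : ℝ≥0∞), (∀ T, Measurable (n T)) →
    tail a (fun T ω => c * n T ω) ≤ c * tail a n
  time_indicator : ∀ a {G : Set Ω}, MeasurableSet G →
    tail a (fun T ω => G.indicator (fun _ => (T : ℝ≥0∞)) ω) ≤ P G
  const : ∀ a (c : ℝ≥0∞), tail a (fun _ _ => c) ≤ c / a
  -- The size is approximated on bounded horizons, which lets the diagonal argument work with
  -- finitely many times at each stage.
  truncate : ∀ a {n : ℕ → Ω → ℝ≥0∞}, (∀ T, Measurable (n T)) →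
    tail a n ≤ ⨆ b : ℕ, tail a (fun T ω => if T ≤ b then n T ω else 0)
  measurable_tail : ∀ a {n : (ℕ → Bool) → ℕ → Ω → ℝ≥0∞},
    (∀ T, Measurable fun p : (ℕ → Bool) × Ω => n p.1 T p.2) → Measurable fun s => tail a (n s)
  -- A convexity property: an average over random labellings `s` can be pulled out of the
  -- functional.
  lintegral_le : ∀ a (μ : Measure (ℕ → Bool)) [IsProbabilityMeasure μ]
    {n : (ℕ → Bool) → ℕ → Ω → ℝ≥0∞},
    (∀ T, Measurable fun p : (ℕ → Bool) × Ω => n p.1 T p.2) →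
    tail a (fun T ω => ∫⁻ s, n s T ω ∂μ) ≤ ∫⁻ s, tail a (n s) ∂μ

section Instances

variable {Ω : Type*} [MeasurableSpace Ω] (P : Measure Ω) [IsProbabilityMeasure P]

theorem const_div_add_le (a k : ℕ) (c : ℝ≥0∞) : c / ((a + k : ℕ) : ℝ≥0∞) ≤ c / a := by
  gcongr
  omega

theorem natCast_div_self_le_one (T : ℕ) : (T : ℝ≥0∞) / T ≤ 1 := ENNReal.div_self_le_one

/-- The expected largest late frequency. -/
noncomputable def strongRate : RateFunctional P where
  tail a n := ∫⁻ ω, ⨆ k : ℕ, n (a + k) ω / ((a + k : ℕ) : ℝ≥0∞) ∂P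
  mono a n m h := by
    gcongr with ω k
    exact h _ _
  anti {a b} n h := by
    refine lintegral_mono fun ω => iSup_le fun k => ?_
    refine le_iSup_of_le (b - a + k) ?_
    rw [show a + (b - a + k) = b + k by omega]
  add a n m hn := by
    rw [← lintegral_add_left]
    · refine lintegral_mono fun ω => iSup_le fun k => ?_
      rw [ENNReal.add_div]
      exact add_le_add (le_iSup (fun k : ℕ => n (a + k) ω / ((a + k : ℕ) : ℝ≥0∞)) k)
        (le_iSup (fun k : ℕ => m (a + k) ω / ((a + k : ℕ) : ℝ≥0∞)) k)
    · exact Measurable.iSup fun k => (hn _).div_const _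
  smul a n c hn := by
    rw [← lintegral_const_mul]
    · refine lintegral_mono fun ω => iSup_le fun k => ?_
      rw [mul_div_assoc]
      gcongr
      exact le_iSup (fun k : ℕ => n (a + k) ω / ((a + k : ℕ) : ℝ≥0∞)) k
    · exact Measurable.iSup fun k => (hn _).div_const _
  time_indicator a G hG := by
    rw [← lintegral_indicator_one hG]
    refine lintegral_mono fun ω => iSup_le fun k => ?_
    by_cases h : ω ∈ G
    · simp only [Set.indicator_of_mem h]
      exact natCast_div_self_le_one _
    · simp [h]
  const a c := by
    calc _ ≤ ∫⁻ _ : Ω, c / a ∂P := lintegral_mono fun ω => iSup_le fun k => const_div_add_le a k c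
      _ = c / a := by simp
  truncate a n hn := by
    -- Monotone convergence in the horizon `b`.
    rw [← lintegral_iSup]
    · refine lintegral_mono fun ω => iSup_le fun k => ?_
      refine le_iSup_of_le (a + k) (le_iSup_of_le k ?_)
      simp
    · intro b
      refine Measurable.iSup fun k => Measurable.div_const ?_ _
      beta_reduce
      split_ifs
      exacts [hn _, measurable_const]
    · intro b c h ω
      refine iSup_mono fun k => ?_
      gcongr
      by_cases h1 : a + k ≤ b
      · simp [h1, h1.trans h]
      · simp [h1]
  measurable_tail a n hn := by
    refine Measurable.lintegral_prod_right (f := fun s ω => ⨆ k : ℕ, n s (a + k) ω / ((a + k : ℕ) : ℝ≥0∞)) ?_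
    exact Measurable.iSup fun k => (hn _).div_const _
  lintegral_le a μ _ n hn := by
    rw [lintegral_lintegral_swap]
    · refine lintegral_mono fun ω => iSup_le fun k => ?_
      have h : Measurable fun s => n s (a + k) ω := (hn (a + k)).comp measurable_prodMk_right
      beta_reduce
      rw [div_eq_mul_inv, ← lintegral_mul_const _ h]
      refine lintegral_mono fun s => ?_
      exact le_iSup (fun k : ℕ => n s (a + k) ω / ((a + k : ℕ) : ℝ≥0∞)) k
    · exact (Measurable.iSup fun k => (hn _).div_const _).aemeasurable

/-- The largest late expected frequency. -/
noncomputable def weakRate : RateFunctional P where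
  tail a n := ⨆ k : ℕ, (∫⁻ ω, n (a + k) ω ∂P) / ((a + k : ℕ) : ℝ≥0∞)
  mono a n m h := by
    gcongr with k ω
    exact h _ _
  anti {a b} n h := by
    refine iSup_le fun k => ?_
    refine le_iSup_of_le (b - a + k) ?_
    rw [show a + (b - a + k) = b + k by omega]
  add a n m hn := by
    refine iSup_le fun k => ?_
    rw [lintegral_add_left (hn _), ENNReal.add_div]
    exact add_le_add (le_iSup (fun k : ℕ => (∫⁻ ω, n (a + k) ω ∂P) / ((a + k : ℕ) : ℝ≥0∞)) k)
        (le_iSup (fun k : ℕ => (∫⁻ ω, m (a + k) ω ∂P) / ((a + k : ℕ) : ℝ≥0∞)) k)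
  smul a n c hn := by
    refine iSup_le fun k => ?_
    rw [lintegral_const_mul _ (hn _), mul_div_assoc]
    gcongr
    exact le_iSup (fun k : ℕ => (∫⁻ ω, n (a + k) ω ∂P) / ((a + k : ℕ) : ℝ≥0∞)) k
  time_indicator a G hG := by
    refine iSup_le fun k => ?_
    rw [lintegral_indicator_const hG, mul_comm, mul_div_assoc]
    exact mul_le_of_le_one_right' (natCast_div_self_le_one _)
  const a c := by
    refine iSup_le fun k => ?_
    simpa using const_div_add_le a k c
  truncate a n hn := by
    refine iSup_le fun k => ?_
    refine le_iSup_of_le (a + k) (le_iSup_of_le k ?_)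
    simp
  measurable_tail a n hn := by
    refine Measurable.iSup fun k => Measurable.div_const ?_ _
    exact Measurable.lintegral_prod_right (f := fun s ω => n s (a + k) ω) (hn _)
  lintegral_le a μ _ n hn := by
    refine iSup_le fun k => ?_
    rw [← lintegral_lintegral_swap (hn (a + k)).aemeasurable, div_eq_mul_inv,
      ← lintegral_mul_const _
        (Measurable.lintegral_prod_right (f := fun s ω => n s (a + k) ω) (hn _))]
    refine lintegral_mono fun s => ?_
    exact le_iSup (fun k : ℕ => (∫⁻ ω, n s (a + k) ω ∂P) / ((a + k : ℕ) : ℝ≥0∞)) k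

end Instances

namespace RateFunctional

variable {Ω : Type*} [MeasurableSpace Ω] {P : Measure Ω} (R : RateFunctional P)

/-- The limiting size of a random count. -/
noncomputable def rate (n : ℕ → Ω → ℝ≥0∞) : ℝ≥0∞ := ⨅ a, R.tail a n

theorem rate_mono {n m : ℕ → Ω → ℝ≥0∞} (h : ∀ T ω, n T ω ≤ m T ω) : R.rate n ≤ R.rate m :=
  iInf_mono fun a => R.mono a h

theorem rate_add_le {n m : ℕ → Ω → ℝ≥0∞} (hn : ∀ T, Measurable (n T)) :
    R.rate (fun T ω => n T ω + m T ω) ≤ R.rate n + R.rate m := by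
  unfold rate
  rw [ENNReal.iInf_add_iInf]
  · exact iInf_mono fun a => R.add a hn
  · exact fun i j => ⟨max i j, add_le_add (R.anti _ (le_max_left _ _)) (R.anti _ (le_max_right _ _))⟩

theorem rate_const_mul_le {n : ℕ → Ω → ℝ≥0∞} {c : ℝ≥0∞} (hc : c ≠ ∞) (hn : ∀ T, Measurable (n T)) :
    R.rate (fun T ω => c * n T ω) ≤ c * R.rate n := by
  unfold rate
  rw [ENNReal.mul_iInf (fun h => absurd h hc)]
  exact iInf_mono fun a => R.smul a c hn

theorem rate_const {c : ℝ≥0∞} (hc : c ≠ ∞) : R.rate (fun _ _ => c) = 0 := by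
  refine le_antisymm (ge_of_tendsto (ENNReal.Tendsto.const_div ENNReal.tendsto_nat_nhds_top
    (Or.inr hc)) (Eventually.of_forall fun a => (iInf_le _ a).trans (R.const a c)) |>.trans ?_) bot_le
  simp

theorem rate_time_le [IsProbabilityMeasure P] : R.rate (fun T _ => (T : ℝ≥0∞)) ≤ 1 := by
  refine (iInf_le _ 0).trans ?_
  simpa using R.time_indicator 0 MeasurableSet.univ

theorem rate_finset_sum_le {ι : Type*} (s : Finset ι) {n : ι → ℕ → Ω → ℝ≥0∞}
    (hn : ∀ i T, Measurable (n i T)) :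
    R.rate (fun T ω => ∑ i ∈ s, n i T ω) ≤ ∑ i ∈ s, R.rate (n i) := by
  classical
  induction s using Finset.induction_on with
  | empty => simpa using (R.rate_const (c := 0) (by simp)).le
  | insert i s hi ih =>
    simp only [Finset.sum_insert hi]
    exact (R.rate_add_le (hn i)).trans (by gcongr)

end RateFunctional

/-! ### Counts of events and cumulative losses -/

open Classical in
/-- The number of times before `T` at which `p` holds. -/
noncomputable def tally (p : ℕ → Prop) (T : ℕ) : ℝ≥0∞ := ∑ t ∈ Finset.range T, if p t then 1 else 0

theorem tally_mono {p q : ℕ → Prop} {T : ℕ} (h : ∀ t < T, p t → q t) : tally p T ≤ tally q T := by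
  classical
  refine Finset.sum_le_sum fun t ht => ?_
  by_cases hp : p t
  · simp [hp, h t (Finset.mem_range.1 ht) hp]
  · simp [hp]

theorem tally_or_le {p q r : ℕ → Prop} {T : ℕ} (h : ∀ t < T, p t → q t ∨ r t) :
    tally p T ≤ tally q T + tally r T := by
  classical
  unfold tally
  rw [← Finset.sum_add_distrib]
  refine Finset.sum_le_sum fun t ht => ?_
  by_cases hp : p t
  · rcases h t (Finset.mem_range.1 ht) hp with h | h <;> simp [hp, h]
  · simp [hp]

theorem tally_exists_le {ι : Type*} (s : Finset ι) {p : ℕ → Prop} {q : ι → ℕ → Prop} {T : ℕ}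
    (h : ∀ t < T, p t → ∃ i ∈ s, q i t) : tally p T ≤ ∑ i ∈ s, tally (q i) T := by
  classical
  unfold tally
  rw [Finset.sum_comm]
  refine Finset.sum_le_sum fun t ht => ?_
  by_cases hp : p t
  · obtain ⟨i, hi, hq⟩ := h t (Finset.mem_range.1 ht) hp
    refine le_trans ?_ (Finset.single_le_sum (fun _ _ => zero_le) hi)
    simp [hp, hq]
  · simp [hp]

theorem tally_le (p : ℕ → Prop) (T : ℕ) : tally p T ≤ T := by
  classical
  refine (Finset.sum_le_sum (g := fun _ => 1) fun t _ => ?_).trans (by simp)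
  split_ifs <;> simp

theorem measurable_tally {Ω : Type*} [MeasurableSpace Ω] {p : Ω → ℕ → Prop}
    (h : ∀ t, MeasurableSet {ω | p ω t}) (T : ℕ) : Measurable fun ω => tally (p ω) T := by
  classical
  refine Finset.measurable_fun_sum _ fun t _ => ?_
  exact Measurable.ite (h t) measurable_const measurable_const

/-- The cumulative loss over the first `T` predictions. -/
noncomputable def cumLoss {X Y : Type*} (loss : Y → Y → ℝ) (f : Rule X Y) (g : X → Y)
    (x : ℕ → X) (T : ℕ) : ℝ≥0∞ :=
  ∑ t ∈ Finset.range T, ENNReal.ofReal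
    (loss (f t (fun i : Fin t => x i) (fun i : Fin t => g (x i)) (x t)) (g (x t)))

theorem cumLoss_le {X Y : Type*} {loss : Y → Y → ℝ} {M : ℝ} (hM : ∀ y₁ y₂, loss y₁ y₂ ≤ M) (f : Rule X Y)
    (g : X → Y) (x : ℕ → X) (T : ℕ) : cumLoss loss f g x T ≤ ENNReal.ofReal M * T := by
  unfold cumLoss
  refine (Finset.sum_le_sum (g := fun _ => ENNReal.ofReal M) fun t _ => ?_).trans ?_
  · exact ENNReal.ofReal_le_ofReal (hM _ _)
  · simp [mul_comm]

/-! ### Random labels, and the sublinear number of visited cells -/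

section FairCoins

/-- A fair coin. -/
noncomputable def fairCoin : Measure Bool := (2⁻¹ : ℝ≥0∞) • (Measure.dirac true + Measure.dirac false)

instance : IsProbabilityMeasure fairCoin := by
  refine ⟨?_⟩
  simp only [fairCoin, Measure.smul_apply, Measure.add_apply, measure_univ, smul_eq_mul]
  rw [one_add_one_eq_two, ENNReal.inv_mul_cancel] <;> simp

theorem map_not_fairCoin : fairCoin.map not = fairCoin := by
  simp only [fairCoin, Measure.map_smul]
  rw [Measure.map_add _ _ (measurable_of_countable _),
    Measure.map_dirac' (measurable_of_countable _), Measure.map_dirac' (measurable_of_countable _),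
    add_comm]
  simp

/-- Independent fair coins. -/
noncomputable def fairCoins : Measure (ℕ → Bool) := Measure.infinitePi fun _ => fairCoin

instance : IsProbabilityMeasure fairCoins := by
  unfold fairCoins
  infer_instance

/-- Flipping one coin acts coordinatewise, by `not` at `k` and the identity elsewhere, and each of
these preserves the fair coin. -/
theorem measurePreserving_flip (k : ℕ) :
    MeasurePreserving (fun s : ℕ → Bool => Function.update s k (!s k)) fairCoins fairCoins := by
  have e : (fun s : ℕ → Bool => Function.update s k (!s k))
      = fun s i => (if i = k then not else id) (s i) := by
    funext s i
    by_cases h : i = k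
    · subst h; simp
    · simp [h]
  rw [e]
  have hm : ∀ i, Measurable (if i = k then not else id : Bool → Bool) := fun i => measurable_of_countable _
  refine ⟨measurable_pi_lambda _ fun i => (hm i).comp (measurable_pi_apply i), ?_⟩
  unfold fairCoins
  rw [Measure.infinitePi_map_pi _ hm]
  congr 1
  funext i
  by_cases h : i = k
  · simp [h, map_not_fairCoin]
  · simp [h]

end FairCoins

section Labels

variable {X Y : Type*}

/-- At the first visit of a cell its label is unpredictable. -/
theorem mul_tally_le_lintegral_cumLoss [MeasurableSpace Y] {loss : Y → Y → ℝ} {f : Rule X Y}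
    (hf : ∀ t (x : Fin t → X) z, Measurable fun y => f t x y z)
    (hmeas : Measurable fun p : Y × Y => loss p.1 p.2) (y : Bool → Y) {κ : ℝ≥0∞}
    (hκ : ∀ y', κ ≤ ENNReal.ofReal (loss y' (y true)) + ENNReal.ofReal (loss y' (y false)))
    (c : X → ℕ) (x : ℕ → X) (T : ℕ) :
    κ * tally (fun t => ∀ u < t, c (x u) ≠ c (x t)) T
      ≤ 2 * ∫⁻ s, cumLoss loss f (fun z => y (s (c z))) x T ∂fairCoins := by
  classical
  have hy : Measurable y := measurable_of_countable _
  have hpred : ∀ t, Measurable fun s : ℕ → Bool =>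
      f t (fun i : Fin t => x i) (fun i : Fin t => y (s (c (x i)))) (x t) := fun t =>
    (hf t _ _).comp (measurable_pi_lambda _ fun i => hy.comp (measurable_pi_apply _))
  have hterm : ∀ t, Measurable fun s : ℕ → Bool => ENNReal.ofReal
      (loss (f t (fun i : Fin t => x i) (fun i : Fin t => y (s (c (x i)))) (x t))
        (y (s (c (x t))))) := fun t =>
    (hmeas.comp ((hpred t).prodMk (hy.comp (measurable_pi_apply _)))).ennreal_ofReal
  unfold cumLoss tally
  rw [lintegral_finsetSum _ fun t _ => hterm t, Finset.mul_sum, Finset.mul_sum]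
  refine Finset.sum_le_sum fun t _ => ?_
  split_ifs with h
  -- Pair each labelling with the one where the coin of the current cell is flipped: twice the
  -- expected loss is the expectation of the sum over the pair.
  · have hflip := (measurePreserving_flip (c (x t))).lintegral_comp (hterm t)
    rw [two_mul]
    nth_rw 1 [← hflip]
    have hflip' := (hterm t).comp (measurePreserving_flip (c (x t))).measurable
    simp only [Function.comp_def] at hflip'
    rw [← lintegral_add_left hflip', mul_one]
    calc κ = ∫⁻ _, κ ∂fairCoins := by simp
      _ ≤ _ := lintegral_mono fun s => ?_
    -- The history lies in other cells, so both members of the pair yield the same prediction, which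
    -- faces both labels.
    have e : ∀ i : Fin t, Function.update s (c (x t)) (!s (c (x t))) (c (x i)) = s (c (x i)) :=
      fun i => Function.update_of_ne (h i i.2) _ _
    simp only [e, Function.update_self]
    cases hs : s (c (x t))
    · simpa using hκ _
    · simpa [add_comm] using hκ _
  · simp

variable [MeasurableSpace X] [MeasurableSpace Y] {Ω : Type*} [MeasurableSpace Ω] {P : Measure Ω}
  [IsProbabilityMeasure P]

theorem measurable_cumLoss_of_measurable {S : Type*} [MeasurableSpace S] {loss : Y → Y → ℝ}
    (hmeas : Measurable fun p : Y × Y => loss p.1 p.2) {f : Rule X Y} (hf : IsLearningRule f)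
    {g : S → X → Y} (hg : Measurable fun p : S × X => g p.1 p.2) {x : S → ℕ → X}
    (hx : ∀ t, Measurable fun s => x s t) (T : ℕ) :
    Measurable fun s => cumLoss loss f (g s) (x s) T := by
  refine Finset.measurable_fun_sum _ fun t _ => Measurable.ennreal_ofReal ?_
  have hgx : ∀ t, Measurable fun s => g s (x s t) := fun t => hg.comp (measurable_id.prodMk (hx t))
  have hfx : Measurable fun s =>
      f t (fun i : Fin t => x s i) (fun i : Fin t => g s (x s i)) (x s t) :=
    (hf t).comp (Measurable.prodMk (measurable_pi_lambda _ fun i : Fin t => hx i)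
      (Measurable.prodMk (measurable_pi_lambda _ fun i : Fin t => hgx i) (hx t)))
  exact hmeas.comp (hfx.prodMk (hgx t))

/-- A process which admits universal learning visits sublinearly many cells of every countable
measurable partition. -/
theorem rate_visits_eq_zero (R : RateFunctional P) {loss : Y → Y → ℝ} {M : ℝ}
    (hM : ∀ y₁ y₂, loss y₁ y₂ ≤ M)
    (hmeas : Measurable fun p : Y × Y => loss p.1 p.2) (y : Bool → Y) {κ : ℝ≥0∞} (hκ₀ : κ ≠ 0)
    (hκ : ∀ y', κ ≤ ENNReal.ofReal (loss y' (y true)) + ENNReal.ofReal (loss y' (y false)))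
    {ξ : ℕ → Ω → X} (hξ : ∀ t, Measurable (ξ t)) {f : Rule X Y} (hf : IsLearningRule f)
    (hcons : ∀ g, Measurable g → R.rate (fun T ω => cumLoss loss f g (fun t => ξ t ω) T) = 0)
    {c : X → ℕ} (hc : Measurable c) :
    R.rate (fun T ω => tally (fun t => ∀ u < t, c (ξ u ω) ≠ c (ξ t ω)) T) = 0 := by
  have hκt : κ ≠ ∞ := ((hκ (y true)).trans_lt (by simp)).ne
  have hy : Measurable y := measurable_of_countable _
  let L : (ℕ → Bool) → ℕ → Ω → ℝ≥0∞ := fun s T ω =>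
    cumLoss loss f (fun z => y (s (c z))) (fun t => ξ t ω) T
  have hlabel : Measurable fun p : (ℕ → Bool) × X => y (p.1 (c p.2)) := by
    have h1 : Measurable fun q : (ℕ → Bool) × ℕ => y (q.1 q.2) :=
      measurable_from_prod_countable_left fun k => hy.comp (measurable_pi_apply k)
    exact h1.comp (measurable_fst.prodMk (hc.comp measurable_snd))
  have hL : ∀ T, Measurable fun p : (ℕ → Bool) × Ω => L p.1 T p.2 := fun T => by
    refine measurable_cumLoss_of_measurable hmeas hf (g := fun (p : (ℕ → Bool) × Ω) z => y (p.1 (c z)))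
      (x := fun p t => ξ t p.2) ?_ (fun t => (hξ t).comp measurable_snd) T
    exact hlabel.comp ((measurable_fst.comp measurable_fst).prodMk measurable_snd)
  have hbound : ∀ a s, R.tail a (L s) ≤ ENNReal.ofReal M := fun a s => by
    calc R.tail a (L s) ≤ R.tail a (fun T _ => ENNReal.ofReal M * T) :=
          R.mono a fun T ω => cumLoss_le hM _ _ _ _
      _ ≤ ENNReal.ofReal M * R.tail a (fun T _ => (T : ℝ≥0∞)) :=
          R.smul a _ fun T => measurable_const
      _ ≤ ENNReal.ofReal M * 1 := by
          gcongr
          simpa using R.time_indicator a MeasurableSet.univ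
      _ = _ := mul_one _
  -- Each fixed labelling is a legitimate target, so consistency applies to it; the uniform bound
  -- `hbound` then permits averaging over labellings by dominated convergence.
  have hlim : ∀ s, Tendsto (fun a => R.tail a (L s)) atTop (𝓝 0) := fun s => by
    have hg : Measurable fun z => y (s (c z)) := hlabel.comp (measurable_const.prodMk measurable_id)
    rw [← hcons _ hg]
    exact tendsto_atTop_iInf fun a b h => R.anti _ h
  have hint : Tendsto (fun a => ∫⁻ s, R.tail a (L s) ∂fairCoins) atTop (𝓝 0) := by
    have := tendsto_lintegral_of_dominated_convergence (μ := fairCoins) (F := fun a s => R.tail a (L s))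
      (f := fun _ => 0) (fun _ => ENNReal.ofReal M) (fun a => R.measurable_tail a hL)
      (fun a => Eventually.of_forall (hbound a)) (by simp) (Eventually.of_forall hlim)
    simpa using this
  have hV : ∀ a, R.tail a (fun T ω => tally (fun t => ∀ u < t, c (ξ u ω) ≠ c (ξ t ω)) T)
      ≤ κ⁻¹ * 2 * ∫⁻ s, R.tail a (L s) ∂fairCoins := fun a => by
    calc _ ≤ R.tail a (fun T ω => κ⁻¹ * 2 * ∫⁻ s, L s T ω ∂fairCoins) := R.mono a fun T ω => by
          have h := mul_tally_le_lintegral_cumLoss (f := f) (fun t x z => (hf t).comp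
            (measurable_const.prodMk (measurable_id.prodMk measurable_const))) hmeas y hκ c
            (fun t => ξ t ω) T
          rw [mul_assoc]
          calc _ = κ⁻¹ * (κ * _) := by rw [← mul_assoc, ENNReal.inv_mul_cancel hκ₀ hκt, one_mul]
            _ ≤ _ := by gcongr
      _ ≤ κ⁻¹ * 2 * R.tail a (fun T ω => ∫⁻ s, L s T ω ∂fairCoins) := by
          refine R.smul a _ fun T => ?_
          exact Measurable.lintegral_prod_left (f := fun s ω => L s T ω) (hL T)
      _ ≤ _ := by
          gcongr
          exact R.lintegral_le a fairCoins hL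
  have hκ2 : κ⁻¹ * 2 ≠ ∞ := ENNReal.mul_ne_top (ENNReal.inv_ne_top.2 hκ₀) (by simp)
  have hfin := ENNReal.Tendsto.const_mul hint (Or.inr hκ2)
  rw [mul_zero] at hfin
  exact le_antisymm (ge_of_tendsto hfin (Eventually.of_forall fun a => (iInf_le _ a).trans (hV a))) bot_le

end Labels

/-! ### Continuity of the new visit rate at the empty set -/

/-- The number of times before `T` at which a point of `C` is visited for the first time. -/
noncomputable def newVisits {X : Type*} (x : ℕ → X) (C : Set X) (T : ℕ) : ℝ≥0∞ :=
  tally (fun t => x t ∈ C ∧ ∀ u < t, x u ≠ x t) T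

theorem exists_measure_le_of_antitone {Ω : Type*} [MeasurableSpace Ω] {P : Measure Ω}
    [IsProbabilityMeasure P] {A : ℕ → Set Ω} (hA : ∀ i, MeasurableSet (A i))
    (hanti : Antitone A) (hempty : ⋂ i, A i = ∅) {ε : ℝ≥0∞} (hε : 0 < ε) (n : ℕ) :
    ∃ m > n, P (A m) ≤ ε := by
  have h := tendsto_measure_iInter_atTop (μ := P) (fun i => (hA i).nullMeasurableSet) hanti
    ⟨0, measure_ne_top _ _⟩
  rw [hempty, measure_empty] at h
  obtain ⟨m, hm, hn⟩ := ((h.eventually (ge_mem_nhds hε)).and (eventually_gt_atTop n)).exists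
  exact ⟨m, hn, hm⟩

/-- Each of the finitely many points before time `b` eventually leaves the decreasing sets, so the
events decrease to the empty set. -/
theorem exists_measure_visit_le {Ω X : Type*} [MeasurableSpace Ω] [MeasurableSpace X]
    {P : Measure Ω} [IsProbabilityMeasure P] {ξ : ℕ → Ω → X} (hξ : ∀ t, Measurable (ξ t)) {C : ℕ → Set X}
    (hC : ∀ i, MeasurableSet (C i)) (hanti : Antitone C) (hempty : ⋂ i, C i = ∅) {ε : ℝ≥0∞}
    (hε : 0 < ε) (b n : ℕ) : ∃ m > n, P {ω | ∃ t < b, ξ t ω ∈ C m} ≤ ε := by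
  refine exists_measure_le_of_antitone (A := fun m => {ω | ∃ t < b, ξ t ω ∈ C m}) (fun i => ?_)
    (fun i j hij ω => ?_) ?_ hε n
  · simp only [Set.ofPred_exists]
    simp only [Set.ofPred_and]
    exact MeasurableSet.iUnion fun t => (MeasurableSet.const _).inter (hξ t (hC i))
  · rintro ⟨t, ht, h⟩
    exact ⟨t, ht, hanti hij h⟩
  · rw [Set.eq_empty_iff_forall_notMem]
    intro ω hω
    simp only [Set.mem_iInter, Set.mem_ofPred_eq] at hω
    have hno : ∀ t, ∃ i, ξ t ω ∉ C i := fun t => by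
      by_contra! h
      exact Set.notMem_empty (ξ t ω) (hempty ▸ Set.mem_iInter.2 h)
    choose i hi using hno
    obtain ⟨t, ht, h⟩ := hω ((Finset.range b).sup i)
    exact hi t (hanti (Finset.le_sup (Finset.mem_range.2 ht)) h)

section Diagonal

variable {X : Type*} [MetricSpace X] [TopologicalSpace.SeparableSpace X] [MeasurableSpace X]
  [BorelSpace X]

theorem exists_measurable_fine_partition {δ : ℝ} (hδ : 0 < δ) :
    ∃ s : X → ℕ, Measurable s ∧ ∀ x y, s x = s y → dist x y < δ := by
  classical
  rcases isEmpty_or_nonempty X with hX | hX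
  · exact ⟨fun _ => 0, measurable_const, fun x => (hX.false x).elim⟩
  have h : ∀ x : X, ∃ i, dist x (TopologicalSpace.denseSeq X i) < δ / 2 := fun x => by
    obtain ⟨i, hi⟩ := (TopologicalSpace.denseRange_denseSeq X).exists_dist_lt x (half_pos hδ)
    exact ⟨i, hi⟩
  refine ⟨fun x => Nat.find (h x), measurable_find h fun i => ?_, fun x y hxy => ?_⟩
  · exact measurableSet_lt (by fun_prop) measurable_const
  · have hx := Nat.find_spec (h x)
    have hy := Nat.find_spec (h y)
    beta_reduce at hxy
    rw [hxy] at hx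
    have := dist_triangle_right x y (TopologicalSpace.denseSeq X (Nat.find (h y)))
    linarith

variable {Ω : Type*} [MeasurableSpace Ω] {P : Measure Ω} {ξ : ℕ → Ω → X}

theorem measurable_newVisits (hξ : ∀ t, Measurable (ξ t)) {C : Set X} (hC : MeasurableSet C)
    (T : ℕ) : Measurable fun ω => newVisits (fun t => ξ t ω) C T := by
  have : SecondCountableTopology X := UniformSpace.secondCountable_of_separable X
  refine measurable_tally (p := fun ω t => ξ t ω ∈ C ∧ ∀ u < t, ξ u ω ≠ ξ t ω) (fun t => ?_) T
  have e : {ω | ξ t ω ∈ C ∧ ∀ u < t, ξ u ω ≠ ξ t ω}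
      = ξ t ⁻¹' C ∩ ⋂ u, ⋂ _ : u < t, {ω | ξ u ω = ξ t ω}ᶜ := by
    ext ω
    simp
  rw [e]
  exact (hξ t hC).inter (MeasurableSet.iInter fun u => MeasurableSet.iInter fun _ =>
    (measurableSet_eq_fun (hξ u) (hξ t)).compl)

variable [IsProbabilityMeasure P]

/-- Finitely many distinct points have a positive minimal distance, so with high probability a
sufficiently fine partition separates those visited before time `b`. -/
theorem exists_partition_measure_collision_le (hξ : ∀ t, Measurable (ξ t)) {ε : ℝ≥0∞}
    (hε : 0 < ε) (b : ℕ) : ∃ s : X → ℕ, Measurable s ∧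
      P {ω | ∃ u < b, ∃ t < b, ξ u ω ≠ ξ t ω ∧ s (ξ u ω) = s (ξ t ω)} ≤ ε := by
  have : SecondCountableTopology X := UniformSpace.secondCountable_of_separable X
  let A : ℕ → Set Ω := fun m => {ω | ∃ u < b, ∃ t < b, ξ u ω ≠ ξ t ω ∧
    dist (ξ u ω) (ξ t ω) < 1 / ((m : ℝ) + 1)}
  obtain ⟨m, -, hm⟩ : ∃ m > 0, P (A m) ≤ ε := by
    refine exists_measure_le_of_antitone (fun i => ?_) (fun i j hij ω => ?_) ?_ hε 0
    · have e : A i = ⋃ u, ⋃ t, ({_ω | u < b} ∩ {_ω | t < b}) ∩ ({ω | ξ u ω = ξ t ω}ᶜ ∩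
          {ω | dist (ξ u ω) (ξ t ω) < 1 / ((i : ℝ) + 1)}) := by
        ext ω
        simp [A]
        grind
      rw [e]
      exact MeasurableSet.iUnion fun u => MeasurableSet.iUnion fun t =>
        ((MeasurableSet.const _).inter (MeasurableSet.const _)).inter
        ((measurableSet_eq_fun (hξ u) (hξ t)).compl.inter
          (measurableSet_lt ((hξ u).dist (hξ t)) measurable_const))
    · rintro ⟨u, hu, t, ht, hne, h⟩
      refine ⟨u, hu, t, ht, hne, h.trans_le ?_⟩
      exact one_div_le_one_div_of_le (by positivity) (by gcongr)
    · rw [Set.eq_empty_iff_forall_notMem]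
      intro ω hω
      simp only [Set.mem_iInter] at hω
      have hno : ∀ q : ℕ × ℕ, ∃ i : ℕ, ξ q.1 ω ≠ ξ q.2 ω →
          1 / ((i : ℝ) + 1) ≤ dist (ξ q.1 ω) (ξ q.2 ω) := fun q => by
        by_cases h : ξ q.1 ω = ξ q.2 ω
        · exact ⟨0, fun h' => absurd h h'⟩
        · obtain ⟨i, hi⟩ := exists_nat_one_div_lt (dist_pos.2 h)
          exact ⟨i, fun _ => hi.le⟩
      choose i hi using hno
      obtain ⟨u, hu, t, ht, hne, h⟩ := hω ((Finset.range b ×ˢ Finset.range b).sup i)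
      have h1 := hi (u, t) hne
      have h2 : i (u, t) ≤ (Finset.range b ×ˢ Finset.range b).sup i :=
        Finset.le_sup (by simp [hu, ht])
      have h3 : 1 / ((((Finset.range b ×ˢ Finset.range b).sup i : ℕ) : ℝ) + 1)
          ≤ 1 / ((i (u, t) : ℝ) + 1) := one_div_le_one_div_of_le (by positivity) (by gcongr)
      exact absurd h (not_lt.2 (h3.trans h1))
  obtain ⟨s, hs, hsd⟩ := exists_measurable_fine_partition (X := X)
    (δ := 1 / ((m : ℝ) + 1)) (by positivity)
  refine ⟨s, hs, (measure_mono ?_).trans hm⟩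
  rintro ω ⟨u, hu, t, ht, hne, h⟩
  exact ⟨u, hu, t, ht, hne, hsd _ _ h⟩

/-- If every countable measurable partition is visited sublinearly, then the rate of new visits is
continuous at the empty set. -/
theorem exists_rate_newVisits_le (R : RateFunctional P) (hξ : ∀ t, Measurable (ξ t))
    (hvisits : ∀ c : X → ℕ, Measurable c →
      R.rate (fun T ω => tally (fun t => ∀ u < t, c (ξ u ω) ≠ c (ξ t ω)) T) = 0)
    {C : ℕ → Set X} (hC : ∀ i, MeasurableSet (C i)) (hanti : Antitone C) (hempty : ⋂ i, C i = ∅)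
    {ε : ℝ≥0∞} (hε : 0 < ε) :
    ∃ n, R.rate (fun T ω => newVisits (fun t => ξ t ω) (C n) T) ≤ ε := by
  classical
  by_contra! hlarge
  have hεt : ε ≠ ∞ := (hlarge 0).ne_top
  have hε4 : 0 < ε / 4 := ENNReal.div_pos hε.ne' (by simp)
  let N : ℕ → ℕ → Ω → ℝ≥0∞ := fun n T ω => newVisits (fun t => ξ t ω) (C n) T
  -- A finite horizon `b n` that already witnesses a late frequency of new visits to `C n` of size
  -- above `ε`.
  have hb : ∀ n, ∃ b : ℕ, ε < R.tail n (fun T ω => if T ≤ b then N n T ω else 0) := fun n => by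
    rw [← lt_iSup_iff]
    exact ((hlarge n).trans_le (iInf_le _ n)).trans_le
      (R.truncate n fun T => measurable_newVisits hξ (hC n) T)
  choose b hb using hb
  -- Up to probability `ε / 4` each, no point before time `b n` lies in `C (m n)`, and `s n`
  -- separates the distinct points before time `b n`.
  choose m hm hmP using fun n => exists_measure_visit_le (P := P) hξ hC hanti hempty hε4 (b n) n
  choose s hs hsP using fun n => exists_partition_measure_collision_le (P := P) hξ hε4 (b n)
  let n : ℕ → ℕ := fun k => m^[k] 0
  have hn : ∀ k, n (k + 1) = m (n k) := fun k => Function.iterate_succ_apply' m k 0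
  have hmono : StrictMono n := strictMono_nat_of_lt_succ fun k => by
    rw [hn]
    exact hm _
  have hexit : ∀ x, ∃ k, x ∉ C (n (k + 1)) := fun x => by
    by_contra! h
    refine Set.notMem_empty x (hempty ▸ Set.mem_iInter.2 fun i => ?_)
    exact hanti ((Nat.le_succ i).trans (hmono.id_le (i + 1))) (h i)
  -- The single bad partition: layer `k` consists of the points that leave the subsequence `C (n ·)`
  -- at step `k + 1` first, and it is subdivided by the partition adapted to the horizon `b (n k)`.
  let e : X → ℕ := fun x => Nat.find (hexit x)
  let c : X → ℕ := fun x => Nat.pair (e x) (s (n (e x)) x)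
  have he : Measurable e := measurable_find hexit fun k => (hC _).compl
  have hc : Measurable c := by
    have h : Measurable fun q : ℕ × X => Nat.pair q.1 (s (n q.1) q.2) :=
      measurable_from_prod_countable_right fun k =>
        (measurable_of_countable (Nat.pair k)).comp (hs (n k))
    exact h.comp (he.prodMk measurable_id)
  let V : ℕ → Ω → ℝ≥0∞ := fun T ω => tally (fun t => ∀ u < t, c (ξ u ω) ≠ c (ξ t ω)) T
  have hVmeas : ∀ T, Measurable (V T) := fun T =>
    measurable_tally (p := fun ω t => ∀ u < t, c (ξ u ω) ≠ c (ξ t ω)) (fun t => by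
      simp only [Set.ofPred_forall]
      exact MeasurableSet.iInter fun u => MeasurableSet.iInter fun _ =>
        (measurableSet_eq_fun (hc.comp (hξ u)) (hc.comp (hξ t))).compl) T
  have hVlarge : ∀ k, ε / 2 ≤ R.tail k V := fun k => by
    let B : Set Ω := {ω | ∃ t < b (n k), ξ t ω ∈ C (n (k + 1))} ∪
      {ω | ∃ u < b (n k), ∃ t < b (n k), ξ u ω ≠ ξ t ω ∧ s (n k) (ξ u ω) = s (n k) (ξ t ω)}
    have hB : P B ≤ ε / 2 := by
      calc P B ≤ ε / 4 + ε / 4 :=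
            (measure_union_le _ _).trans (add_le_add (by rw [hn]; exact hmP _) (hsP _))
        _ = ε / 2 := by
            rw [← ENNReal.add_div, ← two_mul, show (4 : ℝ≥0∞) = 2 * 2 by norm_num,
              ENNReal.mul_div_mul_left _ _ (by simp) (by simp)]
    -- A measurable hull avoids proving that the exceptional event `B` is measurable.
    let G := toMeasurable P B
    have hdom : ∀ T ω, (if T ≤ b (n k) then N (n k) T ω else 0)
        ≤ V T ω + G.indicator (fun _ => (T : ℝ≥0∞)) ω := fun T ω => by
      split_ifs with hT
      · by_cases hω : ω ∈ G
        · rw [Set.indicator_of_mem hω]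
          exact (tally_le _ _).trans le_add_self
        · rw [Set.indicator_of_notMem hω, add_zero]
          have hω' : ω ∉ B := fun h => hω (subset_toMeasurable _ _ h)
          simp only [B, Set.mem_union, Set.mem_ofPred_eq, not_or, not_exists, not_and] at hω'
          refine tally_mono fun t ht ⟨htC, htnew⟩ u hu hcu => ?_
          -- Off `B`, a point of `C (n k)` before the horizon misses `C (n (k + 1))`, so it is in
          -- layer `k`. An earlier point of the same cell would then be a collision of `s (n k)`, so
          -- new points open new cells.
          have hte : e (ξ t ω) = k := (Nat.find_eq_iff _).2 ⟨hω'.1 t (by omega), fun j hj h =>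
            h (hanti (hmono.monotone (by omega)) htC)⟩
          obtain ⟨h1, h2⟩ := Nat.pair_eq_pair.1 hcu
          rw [h1, hte] at h2
          exact hω'.2 u (by omega) t (by omega) (htnew u hu) h2
      · exact zero_le
    have h1 : ε < R.tail (n k) V + ε / 2 := by
      calc ε < _ := hb (n k)
        _ ≤ _ := R.mono _ hdom
        _ ≤ _ := R.add _ hVmeas
        _ ≤ R.tail (n k) V + P G := by
            gcongr
            exact R.time_indicator _ (measurableSet_toMeasurable _ _)
        _ ≤ _ := by
            gcongr
            rwa [measure_toMeasurable]
    have h2 : ε / 2 ≤ R.tail (n k) V := by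
      by_contra! h
      have := ENNReal.add_lt_add_right (a := ε / 2) (by finiteness) h
      rw [ENNReal.add_halves] at this
      exact absurd h1 this.not_gt
    exact h2.trans (R.anti _ (hmono.id_le k))
  have h0 : ε / 2 ≤ R.rate V := le_iInf hVlarge
  rw [hvisits c hc] at h0
  exact absurd h0 (not_le.2 (ENNReal.half_pos hε.ne'))

end Diagonal

/-! ### Capacity of the memory -/

section Memory

variable {X : Type*}

open Classical in
/-- The number of times the stored instances lying in `A` may still be selected before they reach
the cap `2`. -/
noncomputable def Memory.capacity {m : ℕ} (s : Memory m) (x : Fin m → X) (A : Set X) : ℕ :=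
  ∑ u, if u ∈ s.data ∧ x u ∈ A then 2 - s.count u else 0

/-- Some instance is stored, and all stored instances are below the cap `2`. -/
structure Memory.Valid {m : ℕ} (s : Memory m) : Prop where
  nonempty : s.data.Nonempty
  count_le : ∀ u ∈ s.data, s.count u ≤ 1

/-- Stored counts stay below the cap, so every stored point contributes at least one unit; vanishing
capacity therefore means that nothing in `A` is stored. -/
theorem Memory.Valid.capacity_pos {m : ℕ} {s : Memory m} (hs : s.Valid) {x : Fin m → X} {A : Set X}
    {u : Fin m} (hu : u ∈ s.data) (hA : x u ∈ A) : 0 < s.capacity x A := by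
  classical
  refine lt_of_lt_of_le ?_ (Finset.single_le_sum (fun _ _ => Nat.zero_le _) (Finset.mem_univ u))
  have := hs.count_le u hu
  rw [if_pos ⟨hu, hA⟩]
  omega

theorem Memory.exists_of_capacity_pos {m : ℕ} {s : Memory m} {x : Fin m → X} {A : Set X}
    (h : 0 < s.capacity x A) : ∃ u ∈ s.data, x u ∈ A := by
  classical
  obtain ⟨u, -, hu⟩ := Finset.exists_ne_zero_of_sum_ne_zero h.ne'
  have := (ite_ne_right_iff.1 hu).1
  exact ⟨u, this.1, this.2⟩

theorem updateMemory_of_visited {k : ℕ} {sel : Selector X} {n : ℕ} {x : Fin (n + 1) → X} {z : X}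
    {s : Memory (n + 1)} (h : ∃ u, x u = z) : updateMemory k sel n x z s =
      { data := s.data.map Fin.castSuccEmb
        count := Fin.snoc (α := fun _ => ℕ) s.count 0 } := if_pos h

open Classical in
theorem updateMemory_of_new {k : ℕ} {sel : Selector X} {n : ℕ} {x : Fin (n + 1) → X} {z : X}
    {s : Memory (n + 1)} (h : ¬∃ u, x u = z) : updateMemory k sel n x z s =
      { data := insert (Fin.last (n + 1))
          ((if s.count (sel n x z s.data) + 1 = k then s.data.erase (sel n x z s.data)
            else s.data).map Fin.castSuccEmb)
        count := Fin.snoc (α := fun _ => ℕ) (Function.update s.count (sel n x z s.data)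
          (s.count (sel n x z s.data) + 1)) 0 } := by
  simp only [updateMemory, if_neg h]

theorem castSucc_mem_map_castSuccEmb {m : ℕ} {D : Finset (Fin m)} {u : Fin m} :
    u.castSucc ∈ D.map Fin.castSuccEmb ↔ u ∈ D := by
  simp

theorem last_notMem_map_castSuccEmb {m : ℕ} {D : Finset (Fin m)} :
    Fin.last m ∉ D.map Fin.castSuccEmb := by
  simp [Fin.castSucc_ne_last]

theorem Memory.Valid.updateMemory {sel : Selector X} {n : ℕ} {x : Fin (n + 1) → X} {z : X}
    {s : Memory (n + 1)} (hs : s.Valid) : (updateMemory 2 sel n x z s).Valid := by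
  classical
  by_cases h : ∃ u, x u = z
  · rw [updateMemory_of_visited h]
    refine ⟨hs.nonempty.map, fun u => Fin.lastCases (fun hu => ?_) (fun v hv => ?_) u⟩
    · exact absurd hu last_notMem_map_castSuccEmb
    · simpa using hs.count_le v (castSucc_mem_map_castSuccEmb.1 hv)
  · rw [updateMemory_of_new h]
    refine ⟨Finset.insert_nonempty _ _, fun u => Fin.lastCases (fun _ => ?_) (fun v hv => ?_) u⟩
    · simp
    · simp only [Finset.mem_insert, Fin.castSucc_ne_last, castSucc_mem_map_castSuccEmb,
        false_or] at hv
      simp only [Fin.snoc_castSucc, Function.update_apply]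
      by_cases hv' : v = sel n x z s.data
      · rw [if_pos hv', ← hv']
        rw [← hv'] at hv
        split_ifs at hv with h1
        · exact absurd rfl (Finset.ne_of_mem_erase hv)
        · have := hs.count_le v hv
          omega
      · rw [if_neg hv']
        refine hs.count_le v ?_
        split_ifs at hv
        exacts [Finset.mem_of_mem_erase hv, hv]

theorem valid_memory (sel : Selector X) : ∀ (n : ℕ) (x : Fin (n + 1) → X), (memory 2 sel n x).Valid
  | 0, _ => ⟨Finset.singleton_nonempty _, fun _ _ => Nat.zero_le _⟩
  | n + 1, x => (valid_memory sel n (Fin.init x)).updateMemory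

theorem capacity_updateMemory_of_visited {sel : Selector X} {n : ℕ} {x : Fin (n + 2) → X}
    {s : Memory (n + 1)} (h : ∃ u, Fin.init x u = x (Fin.last _)) (A : Set X) :
    (updateMemory 2 sel n (Fin.init x) (x (Fin.last _)) s).capacity x A
      = s.capacity (Fin.init x) A := by
  classical
  rw [updateMemory_of_visited h]
  simp only [Memory.capacity, Fin.sum_univ_castSucc (n := n + 1), castSucc_mem_map_castSuccEmb,
    last_notMem_map_castSuccEmb, Fin.snoc_castSucc]
  simp [Fin.init]
  congr!

open Classical in
-- Balance of one update: the new point enters with count `0` and brings two units, while the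
-- selected point loses one, whether its count rises to `1` or it is removed after its second use.
theorem capacity_updateMemory_of_new {sel : Selector X} {n : ℕ} {x : Fin (n + 2) → X}
    {s : Memory (n + 1)} (hs : s.Valid)
    (hφ : sel n (Fin.init x) (x (Fin.last _)) s.data ∈ s.data)
    (h : ¬∃ u, Fin.init x u = x (Fin.last _)) (A : Set X) :
    (updateMemory 2 sel n (Fin.init x) (x (Fin.last _)) s).capacity x A
      + (if Fin.init x (sel n (Fin.init x) (x (Fin.last _)) s.data) ∈ A then 1 else 0)
      = s.capacity (Fin.init x) A + 2 * (if x (Fin.last _) ∈ A then 1 else 0) := by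
  rw [updateMemory_of_new h]
  generalize sel n (Fin.init x) (x (Fin.last _)) s.data = φ at *
  simp only [Memory.capacity, Fin.sum_univ_castSucc (n := n + 1), Finset.mem_insert,
    castSucc_mem_map_castSuccEmb, Fin.snoc_castSucc, Fin.castSucc_ne_last, false_or, true_or,
    true_and, Fin.snoc_last]
  have e : (if Fin.init x φ ∈ A then 1 else 0)
      = ∑ u, if u = φ then (if Fin.init x u ∈ A then 1 else 0) else 0 := by simp
  have hcount := hs.count_le φ hφ
  rw [add_right_comm, e, ← Finset.sum_add_distrib]
  congr 1
  · refine Finset.sum_congr rfl fun u _ => ?_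
    change (if _ ∧ Fin.init x u ∈ A then _ else _) + _ = _
    by_cases hu : u = φ
    · subst hu
      by_cases hA : Fin.init x u ∈ A
      · by_cases h1 : s.count u + 1 = 2
        · simp [h1, hA, hφ]
          omega
        · simp [h1, hA, hφ]
          omega
      · simp [hA]
    · have : u ∈ (if s.count φ + 1 = 2 then s.data.erase φ else s.data) ↔ u ∈ s.data := by
        split_ifs <;> simp [hu]
      rw [if_neg hu, add_zero, Function.update_of_ne hu]
      simp only [this]
  · split_ifs <;> rfl

end Memory

/-! ### Selections along one trajectory -/

section Path

variable {X : Type*}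

open Classical in
/-- The index among the past instances whose value is predicted at the new instance `z`. -/
noncomputable def neighborIndex (sel : Selector X) (n : ℕ) (x : Fin (n + 1) → X) (z : X) :
    Fin (n + 1) :=
  if h : ∃ u, x u = z then Fin.find (fun u => x u = z) h else sel n x z (memory 2 sel n x).data

theorem kC1NN_succ {Y : Type*} (sel : Selector X) (y₀ : Y) (n : ℕ) (x : Fin (n + 1) → X)
    (y : Fin (n + 1) → Y) (z : X) :
    kC1NN 2 sel y₀ (n + 1) x y z = y (neighborIndex sel n x z) := by
  simp only [kC1NN, neighborIndex]
  split_ifs <;> rfl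

/-- The past instance whose value is predicted at time `t` (and the instance itself at time `0`). -/
noncomputable def neighbor (sel : Selector X) (x : ℕ → X) : ℕ → X
  | 0 => x 0
  | n + 1 => x (neighborIndex sel n (fun i => x i) (x (n + 1)))

/-- The capacity in `A` just before time `t`. -/
noncomputable def capacity (sel : Selector X) (x : ℕ → X) (A : Set X) : ℕ → ℕ
  | 0 => 0
  | n + 1 => (memory 2 sel n (fun i => x i)).capacity (fun i => x i) A

variable {sel : Selector X} {x : ℕ → X}

theorem neighbor_eq_of_visited {t : ℕ} (h : ∃ u < t, x u = x t) : neighbor sel x t = x t := by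
  classical
  obtain ⟨u, hu, hx⟩ := h
  obtain _ | n := t
  · exact absurd hu (Nat.not_lt_zero _)
  · have h : ∃ v : Fin (n + 1), x v = x (n + 1) := ⟨⟨u, hu⟩, hx⟩
    simp only [neighbor, neighborIndex, dif_pos h]
    exact Fin.find_spec h

theorem not_visited_of_neighbor_ne {t : ℕ} (h : neighbor sel x t ≠ x t) : ∀ u < t, x u ≠ x t :=
  fun u hu hx => h (neighbor_eq_of_visited ⟨u, hu, hx⟩)

theorem neighborIndex_of_new {n : ℕ} (h : ∀ u < n + 1, x u ≠ x (n + 1)) :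
    neighborIndex sel n (fun i => x i) (x (n + 1))
      = sel n (fun i => x i) (x (n + 1)) (memory 2 sel n (fun i => x i)).data := by
  have h' : ¬∃ v : Fin (n + 1), x v = x (n + 1) := fun ⟨v, hv⟩ => h v v.2 hv
  simp only [neighborIndex, dif_neg h']

theorem neighbor_ne_of_new {n : ℕ} (h : ∀ u < n + 1, x u ≠ x (n + 1)) :
    neighbor sel x (n + 1) ≠ x (n + 1) := h _ (Fin.is_lt _)

variable [MetricSpace X] [MeasurableSpace X]

open Classical in
-- The condition that the neighbour differs from the point singles out genuine selections: it fails
-- at repeated points, and at time `0`, where the neighbour is the point itself by convention.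
theorem capacity_succ (hsel : IsNearestSelector sel) (A : Set X) (t : ℕ) :
    capacity sel x A (t + 1) + (if neighbor sel x t ∈ A ∧ neighbor sel x t ≠ x t then 1 else 0)
      = capacity sel x A t + 2 * (if x t ∈ A ∧ ∀ u < t, x u ≠ x t then 1 else 0) := by
  obtain _ | n := t
  · by_cases h : x 0 ∈ A <;> simp [capacity, memory, neighbor, Memory.capacity, h]
  by_cases h : ∀ u < n + 1, x u ≠ x (n + 1)
  · have h' : ¬∃ v : Fin (n + 1), x v = x (n + 1) := fun ⟨v, hv⟩ => h v v.2 hv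
    have hv := valid_memory sel n fun i => x i
    have := capacity_updateMemory_of_new (sel := sel) (x := fun i : Fin (n + 2) => x i) hv
      (hsel.mem _ _ _ _ hv.nonempty) h' A
    simp only [and_iff_left (neighbor_ne_of_new (sel := sel) h), and_iff_left h]
    simp only [neighbor, neighborIndex_of_new h]
    exact this
  · have h' : ∃ v : Fin (n + 1), x v = x (n + 1) := by
      push Not at h
      obtain ⟨u, hu, hx⟩ := h
      exact ⟨⟨u, hu⟩, hx⟩
    have hZ : neighbor sel x (n + 1) = x (n + 1) := neighbor_eq_of_visited (by simpa using h)
    simp only [h, hZ, ne_eq, not_true_eq_false, and_false, if_false]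
    exact capacity_updateMemory_of_visited (sel := sel) (x := fun i : Fin (n + 2) => x i) h' A

theorem exists_dist_neighbor_le (hsel : IsNearestSelector sel) {A : Set X} {t : ℕ}
    (ht : ∀ u < t, x u ≠ x t) (h : 0 < capacity sel x A t) :
    ∃ a ∈ A, dist (x t) (neighbor sel x t) ≤ dist (x t) a := by
  obtain _ | n := t
  · exact absurd h (lt_irrefl 0)
  obtain ⟨u, hu, hA⟩ := Memory.exists_of_capacity_pos h
  refine ⟨_, hA, ?_⟩
  simp only [neighbor, neighborIndex_of_new ht]
  exact hsel.dist_le n (fun i => x i) (x (n + 1)) _ ⟨u, hu⟩ u hu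

theorem neighbor_notMem_of_capacity_eq_zero (hsel : IsNearestSelector sel) {A : Set X} {t : ℕ}
    (h : capacity sel x A t = 0) (hne : neighbor sel x t ≠ x t) : neighbor sel x t ∉ A := by
  intro hA
  obtain _ | n := t
  · exact hne rfl
  have hv := valid_memory sel n fun i => x i
  refine (hv.capacity_pos (hsel.mem n (fun i => x i) (x (n + 1)) _ hv.nonempty) ?_).ne' h
  have hnew := not_visited_of_neighbor_ne hne
  simpa only [neighbor, neighborIndex_of_new hnew] using hA

theorem tally_eq_natCast (p : ℕ → Prop) [DecidablePred p] (T : ℕ) :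
    tally p T = ((∑ t ∈ Finset.range T, if p t then 1 else 0 : ℕ) : ℝ≥0∞) := by
  simp only [tally, Nat.cast_sum, Nat.cast_ite, Nat.cast_one, Nat.cast_zero]
  congr! 

/-- Every instance is selected at most twice. -/
theorem tally_neighbor_mem_le (hsel : IsNearestSelector sel) (A : Set X) (T : ℕ) :
    tally (fun t => neighbor sel x t ∈ A ∧ neighbor sel x t ≠ x t) T ≤ 2 * newVisits x A T := by
  classical
  rw [newVisits, tally_eq_natCast, tally_eq_natCast]
  -- Telescoping the balance of `capacity_succ` from capacity `0`.
  have h : capacity sel x A T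
      + (∑ t ∈ Finset.range T, if neighbor sel x t ∈ A ∧ neighbor sel x t ≠ x t then 1 else 0)
      = 2 * ∑ t ∈ Finset.range T, if x t ∈ A ∧ ∀ u < t, x u ≠ x t then 1 else 0 := by
    induction T with
    | zero => simp [capacity]
    | succ T ih =>
      have := capacity_succ (x := x) hsel A T
      rw [Finset.sum_range_succ, Finset.sum_range_succ]
      omega
  exact_mod_cast (Nat.le_add_left _ _).trans h.le

open Classical in
/-- A region runs out of capacity only after two selections from outside of it. -/
theorem two_mul_sum_exhausted_le (hsel : IsNearestSelector sel) (A : Set X) (T : ℕ) :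
    2 * (∑ t ∈ Finset.range T,
        if (x t ∈ A ∧ ∀ u < t, x u ≠ x t) ∧ capacity sel x A t = 0 then 1 else 0)
      ≤ (∑ t ∈ Finset.range T,
          if (neighbor sel x t ∈ A ∧ neighbor sel x t ≠ x t) ∧ x t ∉ A then 1 else 0)
        + min (capacity sel x A T) 2 := by
  -- `min (capacity sel x A T) 2` is a potential. An arrival at exhausted capacity raises it from
  -- `0` to `2`. Only a selection from outside `A` lowers it, by at most one: an arrival inside `A`
  -- adds two units and uses at most one.
  induction T with
  | zero => simp
  | succ T ih =>
    have hstep := capacity_succ (x := x) hsel A T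
    have hzero := neighbor_notMem_of_capacity_eq_zero (x := x) (t := T) hsel (A := A)
    have hnew := not_visited_of_neighbor_ne (sel := sel) (x := x) (t := T)
    rw [Finset.sum_range_succ, Finset.sum_range_succ]
    by_cases hx : x T ∈ A ∧ ∀ u < T, x u ≠ x T
    · by_cases hZ : neighbor sel x T ∈ A ∧ neighbor sel x T ≠ x T
      · have : capacity sel x A T ≠ 0 := fun h => hzero h hZ.2 hZ.1
        rw [if_pos hx, if_pos hZ] at hstep
        rw [if_neg (fun h => this h.2), if_neg (fun h => h.2 hx.1)]
        omega
      · rw [if_pos hx, if_neg hZ] at hstep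
        rw [if_neg (c := (neighbor sel x T ∈ A ∧ neighbor sel x T ≠ x T) ∧ x T ∉ A)
          (fun h => hZ h.1)]
        split_ifs with h
        · have := h.2
          omega
        · omega
    · rw [if_neg hx] at hstep
      rw [if_neg (fun h => hx h.1)]
      by_cases hZ : neighbor sel x T ∈ A ∧ neighbor sel x T ≠ x T
      · have hxA : x T ∉ A := fun h => hx ⟨h, hnew hZ.2⟩
        rw [if_pos hZ] at hstep
        rw [if_pos ⟨hZ, hxA⟩]
        omega
      · rw [if_neg hZ] at hstep
        rw [if_neg (fun h => hZ h.1)]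
        omega

/-- Long edges are rare, compared with shorter edges, if most of the space is covered by finitely
many separated small cells. -/
theorem two_mul_tally_far_le (hsel : IsNearestSelector sel) {k : ℕ} {F : ℕ → Set X} {ρ s : ℝ}
    (hs : 0 < s) (hsρ : s ≤ ρ) (hdiam : ∀ i < k, ∀ a ∈ F i, ∀ b ∈ F i, dist a b ≤ ρ)
    (hsep : ∀ i < k, ∀ j < k, i ≠ j → ∀ a ∈ F i, ∀ b ∈ F j, s ≤ dist a b) (T : ℕ) :
    2 * tally (fun t => ρ < dist (x t) (neighbor sel x t)) T
      ≤ tally (fun t => s / 2 < dist (x t) (neighbor sel x t)) T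
        + 2 * newVisits x (⋃ i ∈ Finset.range k, F i)ᶜ T + 2 * k := by
  classical
  rw [newVisits, tally_eq_natCast, tally_eq_natCast, tally_eq_natCast]
  set C : Set X := (⋃ i ∈ Finset.range k, F i)ᶜ with hC
  have hcover : ∀ z, z ∉ C → ∃ i < k, z ∈ F i := fun z hz => by simpa [hC] using hz
  have hne : ∀ {t}, 0 < dist (x t) (neighbor sel x t) → neighbor sel x t ≠ x t := fun h e =>
    by simp [e] at h
  let e : ℕ → ℕ := fun t => ∑ i ∈ Finset.range k,
    if (x t ∈ F i ∧ ∀ u < t, x u ≠ x t) ∧ capacity sel x (F i) t = 0 then 1 else 0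
  let d : ℕ → ℕ := fun t => ∑ i ∈ Finset.range k,
    if (neighbor sel x t ∈ F i ∧ neighbor sel x t ≠ x t) ∧ x t ∉ F i then 1 else 0
  let l : ℕ → ℕ := fun t =>
    if s ≤ dist (x t) (neighbor sel x t) ∧ dist (x t) (neighbor sel x t) ≤ ρ then 1 else 0
  let c : ℕ → ℕ := fun t => if x t ∈ C ∧ ∀ u < t, x u ≠ x t then 1 else 0
  have he : ∀ t, ∀ i < k, x t ∈ F i → (∀ u < t, x u ≠ x t) → capacity sel x (F i) t = 0 →
      1 ≤ e t := fun t i hi h1 h2 h3 => by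
    refine le_trans ?_ (Finset.single_le_sum (fun _ _ => Nat.zero_le _) (Finset.mem_range.2 hi))
    rw [if_pos ⟨⟨h1, h2⟩, h3⟩]
  have hnear : ∀ t, ∀ i < k, x t ∈ F i → (∀ u < t, x u ≠ x t) → capacity sel x (F i) t ≠ 0 →
      dist (x t) (neighbor sel x t) ≤ ρ := fun t i hi h1 h2 h3 => by
    obtain ⟨a, ha, h⟩ := exists_dist_neighbor_le hsel h2 (Nat.pos_of_ne_zero h3)
    exact h.trans (hdiam i hi _ h1 _ ha)
  -- A selection crossing into a cell comes from the uncovered part `C`, from an exhausted cell, or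
  -- from a cell with capacity left. In the last case the edge is at least `s` long by separation
  -- and at most `ρ` by the diameter bound.
  have hd : ∀ t, d t ≤ c t + e t + l t := fun t => by
    have h1 : d t ≤ 1 := by
      simp only [d, Finset.sum_boole, Nat.cast_id]
      refine Finset.card_le_one.2 fun i hi j hj => ?_
      simp only [Finset.mem_filter, Finset.mem_range] at hi hj
      by_contra hij
      have := hsep i hi.1 j hj.1 hij _ hi.2.1.1 _ hj.2.1.1
      rw [dist_self] at this
      linarith
    rcases Nat.eq_zero_or_pos (d t) with h0 | h0
    · omega
    obtain ⟨i, hi, hi'⟩ := Finset.exists_ne_zero_of_sum_ne_zero h0.ne'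
    obtain ⟨⟨hZ, hZne⟩, hxi⟩ := (ite_ne_right_iff.1 hi').1
    have hnew := not_visited_of_neighbor_ne hZne
    by_cases hxC : x t ∈ C
    · have : c t = 1 := if_pos ⟨hxC, hnew⟩
      omega
    obtain ⟨j, hj, hxj⟩ := hcover _ hxC
    by_cases hcap : capacity sel x (F j) t = 0
    · have := he t j hj hxj hnew hcap
      omega
    · have hij : j ≠ i := fun h => hxi (h ▸ hxj)
      have : l t = 1 := if_pos ⟨hsep j hj i (Finset.mem_range.1 hi) hij _ hxj _ hZ,
        hnear t j hj hxj hnew hcap⟩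
      omega
  have hfar : ∀ t, (if ρ < dist (x t) (neighbor sel x t) then 1 else 0) ≤ c t + e t := fun t => by
    split_ifs with h
    · have hnew := not_visited_of_neighbor_ne (hne ((hs.trans_le hsρ).trans h))
      by_cases hxC : x t ∈ C
      · have : c t = 1 := if_pos ⟨hxC, hnew⟩
        omega
      obtain ⟨j, hj, hxj⟩ := hcover _ hxC
      have := he t j hj hxj hnew (by
        by_contra hcap
        exact absurd h (not_lt.2 (hnear t j hj hxj hnew hcap)))
      omega
    · exact Nat.zero_le _
  -- The two length ranges are disjoint; the threshold `s / 2` turns `s ≤ dist` into a strict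
  -- inequality.
  have hl : ∀ t, (if ρ < dist (x t) (neighbor sel x t) then 1 else 0) + l t
      ≤ if s / 2 < dist (x t) (neighbor sel x t) then 1 else 0 := fun t => by
    simp only [l]
    split_ifs with h1 h2 h3 h3 h2 h3 h3
    all_goals first | omega | (exfalso; first | linarith [h2.1, h2.2] | linarith)
  have hed : 2 * ∑ t ∈ Finset.range T, e t ≤ ∑ t ∈ Finset.range T, d t + 2 * k := by
    simp only [e, d]
    rw [Finset.sum_comm, Finset.sum_comm (s := Finset.range T), Finset.mul_sum]
    calc _ ≤ ∑ i ∈ Finset.range k, ((∑ t ∈ Finset.range T,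
          if (neighbor sel x t ∈ F i ∧ neighbor sel x t ≠ x t) ∧ x t ∉ F i then 1 else 0) + 2) :=
          Finset.sum_le_sum fun i _ => (two_mul_sum_exhausted_le hsel (F i) T).trans (by omega)
      _ = _ := by simp [Finset.sum_add_distrib, mul_comm]
  have hdT := Finset.sum_le_sum fun t (_ : t ∈ Finset.range T) => hd t
  have hfarT := Finset.sum_le_sum fun t (_ : t ∈ Finset.range T) => hfar t
  have hlT := Finset.sum_le_sum fun t (_ : t ∈ Finset.range T) => hl t
  simp only [Finset.sum_add_distrib] at hdT hfarT hlT
  change _ ≤ _ + 2 * ((∑ t ∈ Finset.range T, c t : ℕ) : ℝ≥0∞) + _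
  -- From `2 ∑ e ≤ ∑ d + 2k` and `d ≤ c + e + l` one copy of `∑ e` cancels, giving `∑ e ≤ ∑ c + ∑ l
  -- + 2k`; adding the far edges, which are at most `c + e`, closes the estimate.
  have : 2 * (∑ t ∈ Finset.range T, if ρ < dist (x t) (neighbor sel x t) then 1 else 0)
      ≤ (∑ t ∈ Finset.range T, if s / 2 < dist (x t) (neighbor sel x t) then 1 else 0)
        + 2 * (∑ t ∈ Finset.range T, c t) + 2 * k := by omega
  exact_mod_cast this

end Path

/-! ### Separated cells -/

/-- A separable metric space is covered, up to a vanishing part, by finitely many separated small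
closed cells. -/
theorem exists_separated_cells {X : Type*} [MetricSpace X] [TopologicalSpace.SeparableSpace X]
    {ρ : ℝ} (hρ : 0 < ρ) : ∃ (s : ℕ → ℝ) (F : ℕ → ℕ → Set X),
      (∀ n, 0 < s n ∧ s n ≤ ρ) ∧ (∀ n i, IsClosed (F n i)) ∧
      (∀ n i, ∀ a ∈ F n i, ∀ b ∈ F n i, dist a b ≤ ρ) ∧
      (∀ n i j, i ≠ j → ∀ a ∈ F n i, ∀ b ∈ F n j, s n ≤ dist a b) ∧
      Antitone (fun n => (⋃ i ∈ Finset.range n, F n i)ᶜ) ∧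
      ⋂ n, (⋃ i ∈ Finset.range n, F n i)ᶜ = ∅ := by
  classical
  rcases isEmpty_or_nonempty X with hX | hX
  · refine ⟨fun _ => ρ, fun _ _ => ∅, fun _ => ⟨hρ, le_rfl⟩, fun _ _ => isClosed_empty,
      by simp, by simp, fun _ _ _ => by simp, ?_⟩
    exact Set.eq_empty_of_isEmpty _
  let p : ℕ → X := TopologicalSpace.denseSeq X
  let w : ℕ → ℝ := fun n => 1 / ((n : ℝ) + 1)
  have hw : ∀ n, 0 < w n := fun n => by positivity
  have hwanti : ∀ {n m}, n ≤ m → w m ≤ w n := fun h =>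
    one_div_le_one_div_of_le (by positivity) (by gcongr)
  -- Disjointified balls of radius `ρ / 2`, with an extra collar of width `w n` removed around the
  -- earlier balls. The collar is the separation, and it shrinks as `n` grows.
  let F : ℕ → ℕ → Set X := fun n i =>
    Metric.closedBall (p i) (ρ / 2) \ ⋃ j ∈ Finset.range i, Metric.ball (p j) (ρ / 2 + w n)
  have hmem : ∀ {n i z}, z ∈ F n i ↔ dist z (p i) ≤ ρ / 2 ∧ ∀ j < i, ρ / 2 + w n ≤ dist z (p j) := by
    intro n i z
    simp [F]
  have hlt : ∀ n i j, i < j → ∀ a ∈ F n i, ∀ b ∈ F n j, w n ≤ dist a b := fun n i j hij a ha b hb => by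
    have h1 := (hmem.1 ha).1
    have h2 := (hmem.1 hb).2 i hij
    have := dist_triangle_left b (p i) a
    linarith
  refine ⟨fun n => min (w n) ρ, F, fun n => ⟨lt_min (hw n) hρ, min_le_right _ _⟩, fun n i => ?_,
    fun n i a ha b hb => ?_, fun n i j hij a ha b hb => (min_le_left _ _).trans ?_,
    fun n m hnm z hz => ?_, ?_⟩
  · change IsClosed (_ ∩ _ᶜ)
    refine Metric.isClosed_closedBall.inter ?_
    exact (isOpen_biUnion fun j _ => Metric.isOpen_ball).isClosed_compl
  · have := dist_triangle_right a b (p i)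
    linarith [(hmem.1 ha).1, (hmem.1 hb).1]
  · rcases lt_or_gt_of_ne hij with h | h
    · exact hlt n i j h a ha b hb
    · rw [dist_comm]
      exact hlt n j i h b hb a ha
  · contrapose! hz
    simp only [Set.mem_compl_iff, not_not, Set.mem_iUnion, Finset.mem_range, exists_prop] at hz ⊢
    obtain ⟨i, hi, h⟩ := hz
    refine ⟨i, hi.trans_le hnm, hmem.2 ⟨(hmem.1 h).1, fun j hj => ?_⟩⟩
    have := (hmem.1 h).2 j hj
    have := hwanti hnm
    linarith
  · rw [Set.eq_empty_iff_forall_notMem]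
    intro z hz
    have hex : ∃ i, dist z (p i) ≤ ρ / 2 := by
      obtain ⟨i, hi⟩ := (TopologicalSpace.denseRange_denseSeq X).exists_dist_lt z (half_pos hρ)
      exact ⟨i, hi.le⟩
    let i := Nat.find hex
    -- By minimality of `i`, the point lies strictly outside the finitely many earlier closed balls,
    -- so thin enough collars miss it.
    have hgap : ∃ n, ∀ j < i, ρ / 2 + w n ≤ dist z (p j) := by
      have h : ∀ j, ∃ n, j < i → ρ / 2 + w n ≤ dist z (p j) := fun j => by
        by_cases hj : j < i
        · obtain ⟨n, hn⟩ := exists_nat_one_div_lt (sub_pos.2 (not_le.1 (Nat.find_min hex hj)))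
          exact ⟨n, fun _ => by linarith [show w n < _ from hn]⟩
        · exact ⟨0, fun h => absurd h hj⟩
      choose n hn using h
      refine ⟨(Finset.range i).sup n, fun j hj => ?_⟩
      have := hn j hj
      have := hwanti (Finset.le_sup (f := n) (Finset.mem_range.2 hj))
      linarith
    obtain ⟨n, hn⟩ := hgap
    have h := Set.mem_iInter.1 hz (max n (i + 1))
    simp only [Set.mem_compl_iff, Set.mem_iUnion, Finset.mem_range, exists_prop, not_exists,
      not_and] at h
    refine h i (lt_of_lt_of_le (Nat.lt_succ_self i) (le_max_right _ _))
      (hmem.2 ⟨Nat.find_spec hex, fun j hj => ?_⟩)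
    have := hn j hj
    have := hwanti (le_max_left n (i + 1))
    linarith

/-! ### Measurability of the rule -/

section Measurability

/-- There are only countably many memory states, so with the discrete σ-algebra joint measurability
can be checked with the state frozen. -/
instance (m : ℕ) : MeasurableSpace (Memory m) := ⊤

instance (m : ℕ) : DiscreteMeasurableSpace (Memory m) := ⟨fun _ => trivial⟩

instance (m : ℕ) : Countable (Memory m) :=
  Function.Injective.countable (f := fun s : Memory m => (s.data, s.count)) fun s t h => by
    cases s
    cases t
    simpa using h

variable {X : Type*} [MetricSpace X] [TopologicalSpace.SeparableSpace X] [MeasurableSpace X]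
  [BorelSpace X] {sel : Selector X}

theorem measurableSet_visited (n : ℕ) :
    MeasurableSet {q : (Fin n → X) × X | ∃ u, q.1 u = q.2} := by
  have : SecondCountableTopology X := UniformSpace.secondCountable_of_separable X
  have e : {q : (Fin n → X) × X | ∃ u, q.1 u = q.2} = ⋃ u, {q | q.1 u = q.2} := by
    ext
    simp
  rw [e]
  exact MeasurableSet.iUnion fun u => measurableSet_eq_fun (by fun_prop) (by fun_prop)

theorem measurable_memory (hsel : IsNearestSelector sel) (k : ℕ) :
    ∀ n, Measurable (memory k sel n)
  | 0 => measurable_const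
  | n + 1 => by
    classical
    have h : Measurable fun q : ((Fin (n + 1) → X) × X) × Memory (n + 1) =>
        updateMemory k sel n q.1.1 q.1.2 q.2 := by
      refine measurable_from_prod_countable_left fun s => ?_
      exact Measurable.ite (measurableSet_visited (n + 1))
        (measurable_const (a := ({
          data := s.data.map Fin.castSuccEmb
          count := Fin.snoc (α := fun _ => ℕ) s.count 0 } : Memory (n + 2))))
        ((measurable_of_countable fun φ : Fin (n + 1) => ({
          data := insert (Fin.last (n + 1))
            ((if s.count φ + 1 = k then s.data.erase φ else s.data).map Fin.castSuccEmb)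
          count := Fin.snoc (α := fun _ => ℕ) (Function.update s.count φ (s.count φ + 1)) 0 } :
            Memory (n + 2))).comp (hsel.measurable n s.data))
    have hinit : Measurable fun x : Fin (n + 2) → X => (Fin.init x : Fin (n + 1) → X) :=
      measurable_pi_lambda _ fun i => measurable_pi_apply _
    exact h.comp ((hinit.prodMk (measurable_pi_apply _)).prodMk
      ((measurable_memory hsel k n).comp hinit))

theorem measurable_neighborIndex (hsel : IsNearestSelector sel) (n : ℕ) :
    Measurable fun q : (Fin (n + 1) → X) × X => neighborIndex sel n q.1 q.2 := by
  classical
  have : SecondCountableTopology X := UniformSpace.secondCountable_of_separable X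
  have hs : Measurable fun q : (Fin (n + 1) → X) × X => sel n q.1 q.2 (memory 2 sel n q.1).data := by
    have h : Measurable fun r : ((Fin (n + 1) → X) × X) × Memory (n + 1) =>
        sel n r.1.1 r.1.2 r.2.data :=
      measurable_from_prod_countable_left fun s => hsel.measurable n s.data
    exact h.comp (measurable_id.prodMk ((measurable_memory hsel 2 n).comp measurable_fst))
  refine measurable_to_countable' fun i => ?_
  have e : (fun q : (Fin (n + 1) → X) × X => neighborIndex sel n q.1 q.2) ⁻¹' {i}
      = ({q | q.1 i = q.2} ∩ ⋂ j, ⋂ _ : j < i, {q | q.1 j = q.2}ᶜ) ∪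
        ({q | ∃ u, q.1 u = q.2}ᶜ ∩
          (fun q : (Fin (n + 1) → X) × X => sel n q.1 q.2 (memory 2 sel n q.1).data) ⁻¹' {i}) := by
    ext q
    by_cases h : ∃ u, q.1 u = q.2
    · have hi : neighborIndex sel n q.1 q.2 = Fin.find (fun u => q.1 u = q.2) h := dif_pos h
      simp only [hi, Set.mem_preimage, Set.mem_singleton_iff, Set.mem_union,
        Set.mem_inter_iff, Set.mem_compl_iff, Set.mem_ofPred_eq, h, not_true_eq_false, false_and,
        or_false, Set.mem_iInter]
      exact Fin.find_eq_iff h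
    · have h' : q.1 i ≠ q.2 := fun hi => h ⟨i, hi⟩
      have hi : neighborIndex sel n q.1 q.2 = sel n q.1 q.2 (memory 2 sel n q.1).data := dif_neg h
      simp only [hi, Set.mem_preimage, Set.mem_singleton_iff, Set.mem_union,
        Set.mem_inter_iff, Set.mem_compl_iff, Set.mem_ofPred_eq, h, not_false_eq_true, true_and,
        h', false_and, false_or]
  have heq : ∀ j : Fin (n + 1), MeasurableSet {q : (Fin (n + 1) → X) × X | q.1 j = q.2} :=
    fun j => measurableSet_eq_fun (by fun_prop) (by fun_prop)
  rw [e]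
  exact ((heq i).inter (MeasurableSet.iInter fun j => MeasurableSet.iInter fun _ =>
    (heq j).compl)).union ((measurableSet_visited _).compl.inter (hs (measurableSet_singleton i)))

theorem isLearningRule_kC1NN {Y : Type*} [MeasurableSpace Y] (hsel : IsNearestSelector sel)
    (y₀ : Y) : IsLearningRule (kC1NN 2 sel y₀) := by
  rintro (_ | n)
  · exact measurable_const
  · simp only [kC1NN_succ]
    have h : Measurable fun r : ((Fin (n + 1) → X) × (Fin (n + 1) → Y) × X) × Fin (n + 1) =>
        r.1.2.1 r.2 :=
      measurable_from_prod_countable_left fun i =>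
        (measurable_pi_apply i).comp (measurable_fst.comp measurable_snd)
    exact h.comp (measurable_id.prodMk ((measurable_neighborIndex hsel n).comp
      (measurable_fst.prodMk (measurable_snd.comp measurable_snd))))

theorem measurable_neighbor {Ω : Type*} [MeasurableSpace Ω] {ξ : ℕ → Ω → X}
    (hsel : IsNearestSelector sel) (hξ : ∀ t, Measurable (ξ t)) :
    ∀ t, Measurable fun ω => neighbor sel (fun t => ξ t ω) t
  | 0 => hξ 0
  | n + 1 => by
    have h : Measurable fun r : Ω × Fin (n + 1) => ξ r.2 r.1 :=
      measurable_from_prod_countable_left fun i => hξ i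
    have hidx : Measurable fun ω => neighborIndex sel n (fun i : Fin (n + 1) => ξ i ω) (ξ (n + 1) ω) :=
      (measurable_neighborIndex hsel n).comp
        (Measurable.prodMk (measurable_pi_lambda _ fun i : Fin (n + 1) => hξ i) (hξ (n + 1)))
    exact h.comp (measurable_id.prodMk hidx)

end Measurability

/-- The factor `3` is one for the new point itself lying in `C` and two for its neighbour lying
there, by the cap. -/
theorem tally_le_add_newVisits {X : Type*} [MetricSpace X] [MeasurableSpace X] {sel : Selector X}
    (hsel : IsNearestSelector sel) {x : ℕ → X} {C : Set X}
    {p q : ℕ → Prop} {T : ℕ}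
    (h : ∀ t, p t → neighbor sel x t ≠ x t ∧ (q t ∨ x t ∈ C ∨ neighbor sel x t ∈ C)) :
    tally p T ≤ tally q T + 3 * newVisits x C T := by
  calc tally p T ≤ tally q T + tally (fun t => neighbor sel x t ≠ x t ∧
        (x t ∈ C ∨ neighbor sel x t ∈ C)) T := tally_or_le fun t _ hp => by
        obtain ⟨h1, h2⟩ := h t hp
        tauto
    _ ≤ tally q T + (newVisits x C T
          + tally (fun t => neighbor sel x t ∈ C ∧ neighbor sel x t ≠ x t) T) := by
        gcongr
        refine tally_or_le fun t _ hp => ?_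
        have := not_visited_of_neighbor_ne hp.1
        tauto
    _ ≤ tally q T + (newVisits x C T + 2 * newVisits x C T) := by
        gcongr
        exact tally_neighbor_mem_le hsel C T
    _ = _ := by ring

/-! ### Consistency of 2C1NN from the continuity of the visit rate -/

section Sufficiency

variable {X : Type*} [MetricSpace X] [TopologicalSpace.SeparableSpace X] [MeasurableSpace X]
  [BorelSpace X] {sel : Selector X} {Ω : Type*} [MeasurableSpace Ω] {P : Measure Ω}
  {ξ : ℕ → Ω → X}

/-- The rate of new visits of a set is continuous at the empty set. -/
def HasContinuousVisitRate (R : RateFunctional P) (ξ : ℕ → Ω → X) : Prop :=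
  ∀ C : ℕ → Set X, (∀ i, MeasurableSet (C i)) → Antitone C → ⋂ i, C i = ∅ →
    ∀ ε : ℝ≥0∞, 0 < ε → ∃ n, R.rate (fun T ω => newVisits (fun t => ξ t ω) (C n) T) ≤ ε

/-- The form in which continuity is used: a count is negligible if, off sets decreasing to the empty
set, it is controlled by negligible counts. -/
theorem rate_eq_zero_of_le_newVisits {R : RateFunctional P} (hξ : ∀ t, Measurable (ξ t))
    (hR : HasContinuousVisitRate R ξ) {C : ℕ → Set X} (hC : ∀ i, MeasurableSet (C i))
    (hanti : Antitone C) (hempty : ⋂ i, C i = ∅) {m : ℕ → Ω → ℝ≥0∞} {q : ℕ → ℕ → Ω → ℝ≥0∞}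
    (hq : ∀ n T, Measurable (q n T)) (hq₀ : ∀ n, R.rate (q n) = 0)
    (h : ∀ n T ω, m T ω ≤ q n T ω + 3 * newVisits (fun t => ξ t ω) (C n) T) : R.rate m = 0 := by
  refine le_antisymm (le_of_forall_gt_imp_ge_of_dense fun δ hδ => ?_) bot_le
  obtain ⟨n, hn⟩ := hR C hC hanti hempty (δ / 3) (ENNReal.div_pos hδ.ne' (by simp))
  calc R.rate m ≤ _ := R.rate_mono (h n)
    _ ≤ _ := R.rate_add_le (hq n)
    _ ≤ 0 + 3 * R.rate (fun T ω => newVisits (fun t => ξ t ω) (C n) T) :=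
        add_le_add (hq₀ n).le (R.rate_const_mul_le (by simp) fun T => measurable_newVisits hξ (hC n) T)
    _ ≤ 0 + 3 * (δ / 3) := by gcongr
    _ = δ := by rw [zero_add, ENNReal.mul_div_cancel (by simp) (by simp)]

variable [IsProbabilityMeasure P]

theorem measurable_tally_far (hsel : IsNearestSelector sel) (hξ : ∀ t, Measurable (ξ t)) (ρ : ℝ)
    (T : ℕ) : Measurable fun ω =>
      tally (fun t => ρ < dist (ξ t ω) (neighbor sel (fun t => ξ t ω) t)) T := by
  have : SecondCountableTopology X := UniformSpace.secondCountable_of_separable X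
  exact measurable_tally (p := fun ω t => ρ < dist (ξ t ω) (neighbor sel (fun t => ξ t ω) t))
    (fun t => measurableSet_lt measurable_const ((hξ t).dist (measurable_neighbor hsel hξ t))) T

/-- Nearest neighbours are close, except at a vanishing proportion of the times. -/
theorem rate_far_eq_zero {R : RateFunctional P} (hsel : IsNearestSelector sel)
    (hξ : ∀ t, Measurable (ξ t)) (hR : HasContinuousVisitRate R ξ) {ρ : ℝ} (hρ : 0 < ρ) :
    R.rate (fun T ω =>
      tally (fun t => ρ < dist (ξ t ω) (neighbor sel (fun t => ξ t ω) t)) T) = 0 := by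
  let far : ℝ → ℕ → Ω → ℝ≥0∞ := fun ρ T ω =>
    tally (fun t => ρ < dist (ξ t ω) (neighbor sel (fun t => ξ t ω) t)) T
  have hfar : ∀ ρ T, Measurable (far ρ T) := measurable_tally_far hsel hξ
  let S : ℝ≥0∞ := ⨆ ρ : {ρ : ℝ // 0 < ρ}, R.rate (far ρ)
  have hS1 : S ≤ 1 := iSup_le fun ρ => (R.rate_mono fun T ω => tally_le _ _).trans R.rate_time_le
  -- The self-bounding inequality: the uncovered part is made rare by continuity, and the additive
  -- constant `2 * n` disappears in the rate.
  have hstep : ∀ ρ : {ρ : ℝ // 0 < ρ}, ∀ ε : ℝ≥0∞, 0 < ε → R.rate (far ρ) ≤ S / 2 + ε := by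
    rintro ⟨ρ, hρ⟩ ε hε
    obtain ⟨s, F, hs, hF, hdiam, hsep, hanti, hempty⟩ := exists_separated_cells (X := X) hρ
    have hC : ∀ n, MeasurableSet (⋃ i ∈ Finset.range n, F n i)ᶜ := fun n =>
      (Finset.measurableSet_biUnion _ fun i _ => (hF n i).measurableSet).compl
    obtain ⟨n, hn⟩ := hR _ hC hanti hempty ε hε
    let N : ℕ → Ω → ℝ≥0∞ := fun T ω =>
      newVisits (fun t => ξ t ω) (⋃ i ∈ Finset.range n, F n i)ᶜ T
    have hN : ∀ T, Measurable (N T) := measurable_newVisits hξ (hC n)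
    have hle : ∀ T ω, far ρ T ω ≤ 2⁻¹ * (far (s n / 2) T ω + 2 * N T ω + 2 * n) := fun T ω => by
      have := two_mul_tally_far_le (k := n) (x := fun t => ξ t ω) hsel (hs n).1 (hs n).2
        (fun i _ => hdiam n i) (fun i _ j _ => hsep n i j) T
      calc far ρ T ω = 2⁻¹ * (2 * far ρ T ω) := by
            rw [← mul_assoc, ENNReal.inv_mul_cancel (by simp) (by simp), one_mul]
        _ ≤ _ := by gcongr
    calc R.rate (far ρ) ≤ _ := R.rate_mono hle
      _ ≤ 2⁻¹ * R.rate (fun T ω => far (s n / 2) T ω + 2 * N T ω + 2 * n) :=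
          R.rate_const_mul_le (by simp) fun T =>
            ((hfar _ T).add ((hN T).const_mul _)).add measurable_const
      _ ≤ 2⁻¹ * (R.rate (far (s n / 2)) + 2 * R.rate N + 0) := by
          gcongr
          refine (R.rate_add_le fun T => (hfar _ T).add ((hN T).const_mul _)).trans ?_
          refine add_le_add ((R.rate_add_le (hfar _)).trans ?_)
            (R.rate_const (ENNReal.mul_ne_top (by simp) (by simp))).le
          gcongr
          exact R.rate_const_mul_le (by simp) hN
      _ ≤ 2⁻¹ * (S + 2 * ε + 0) := by
          gcongr
          exact le_iSup (fun ρ : {ρ : ℝ // 0 < ρ} => R.rate (far ρ)) ⟨s n / 2, half_pos (hs n).1⟩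
      _ = S / 2 + ε := by
          rw [add_zero, mul_add, ← mul_assoc, ENNReal.inv_mul_cancel (by simp) (by simp), one_mul,
            ENNReal.div_eq_inv_mul]
  have hS2 : S ≤ S / 2 := iSup_le fun ρ => by
    refine ENNReal.le_of_forall_pos_le_add fun ε hε _ => hstep ρ ε (by exact_mod_cast hε)
  -- Finiteness of `S`, from `hS1`, is needed here: `∞` also satisfies `S ≤ S / 2`.
  have hS0 : S = 0 := by
    by_contra h
    exact absurd hS2 (not_le.2 (ENNReal.half_lt_self h (hS1.trans_lt ENNReal.one_lt_top).ne))
  exact le_antisymm ((le_iSup (fun ρ : {ρ : ℝ // 0 < ρ} => R.rate (far ρ)) ⟨ρ, hρ⟩).trans hS0.le)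
    bot_le

theorem measurable_tally_mistake (hsel : IsNearestSelector sel) (hξ : ∀ t, Measurable (ξ t))
    {A : Set X} (hA : MeasurableSet A) (T : ℕ) : Measurable fun ω =>
      tally (fun t => ¬(ξ t ω ∈ A ↔ neighbor sel (fun t => ξ t ω) t ∈ A)) T :=
  measurable_tally (p := fun ω t => ¬(ξ t ω ∈ A ↔ neighbor sel (fun t => ξ t ω) t ∈ A))
    (fun t => (MeasurableSet.iff (hξ t hA) (measurable_neighbor hsel hξ t hA)).compl) T

/-- The nearest neighbour lies on the same side of a measurable set, except at a vanishing
proportion of the times. -/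
theorem rate_mistake_eq_zero {R : RateFunctional P} (hsel : IsNearestSelector sel)
    (hξ : ∀ t, Measurable (ξ t)) (hR : HasContinuousVisitRate R ξ) {A : Set X}
    (hA : MeasurableSet A) :
    R.rate (fun T ω =>
      tally (fun t => ¬(ξ t ω ∈ A ↔ neighbor sel (fun t => ξ t ω) t ∈ A)) T) = 0 := by
  have hmoved : ∀ {x : ℕ → X} {A : Set X} {t}, ¬(x t ∈ A ↔ neighbor sel x t ∈ A) →
      neighbor sel x t ≠ x t := fun h e => h (by rw [e])
  induction A, hA using MeasurableSet.induction_on_open with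
  | isOpen U hU =>
    let w : ℕ → ℝ := fun n => 1 / ((n : ℝ) + 1)
    have hw : ∀ n, 0 < w n := fun n => by positivity
    -- The part of `U` close to its complement; it decreases to the empty set as `U` is open. A
    -- short edge crossing the boundary has its endpoint in `U` there.
    let C : ℕ → Set X := fun n => U ∩ ⋃ y ∈ Uᶜ, Metric.ball y (w n)
    have hC : ∀ n {x}, x ∈ C n ↔ x ∈ U ∧ ∃ y ∉ U, dist x y < w n := by simp [C]
    refine rate_eq_zero_of_le_newVisits hξ hR (C := C) (fun n => ?_) (fun n m h x hx => ?_) ?_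
      (q := fun n T ω => tally (fun t => w n / 2 < dist (ξ t ω) (neighbor sel (fun t => ξ t ω) t)) T)
      (fun n T => measurable_tally_far hsel hξ _ T)
      (fun n => rate_far_eq_zero hsel hξ hR (half_pos (hw n)))
      (fun n T ω => tally_le_add_newVisits hsel fun t ht => ⟨hmoved ht, ?_⟩)
    · exact hU.measurableSet.inter (isOpen_biUnion fun y _ => Metric.isOpen_ball).measurableSet
    · obtain ⟨hxU, y, hy, hd⟩ := (hC _).1 hx
      refine (hC _).2 ⟨hxU, y, hy, hd.trans_le ?_⟩
      exact one_div_le_one_div_of_le (by positivity) (by gcongr)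
    · rw [Set.eq_empty_iff_forall_notMem]
      intro x hx
      have hx' := fun n => (hC n).1 (Set.mem_iInter.1 hx n)
      obtain ⟨r, hr, hball⟩ := Metric.isOpen_iff.1 hU x (hx' 0).1
      obtain ⟨n, hn⟩ := exists_nat_one_div_lt hr
      obtain ⟨-, y, hy, hd⟩ := hx' n
      exact hy (hball (Metric.mem_ball'.2 (hd.trans hn)))
    · rcases lt_or_ge (w n / 2) (dist (ξ t ω) (neighbor sel (fun t => ξ t ω) t)) with h | h
      · exact Or.inl h
      · have hlt : dist (ξ t ω) (neighbor sel (fun t => ξ t ω) t) < w n :=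
          h.trans_lt (half_lt_self (hw n))
        right
        by_cases h1 : ξ t ω ∈ U
        · exact Or.inl ((hC n).2 ⟨h1, _, fun h2 => ht (iff_of_true h1 h2), hlt⟩)
        · refine Or.inr ((hC n).2 ⟨?_, _, h1, by rwa [dist_comm]⟩)
          by_contra h2
          exact ht (iff_of_false h1 h2)
  | compl A hA ih =>
    simp only [Set.mem_compl_iff, not_iff_not]
    exact ih
  | iUnion f hdisj hf ih =>
    -- Tails of the disjoint union decrease to the empty set, leaving finitely many sets to which
    -- the induction hypothesis applies.
    let C : ℕ → Set X := fun n => ⋃ i, ⋃ _ : n ≤ i, f i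
    have hC : ∀ n {x}, x ∈ C n ↔ ∃ i, n ≤ i ∧ x ∈ f i := by simp [C]
    have hq : ∀ i T, Measurable fun ω =>
        tally (fun t => ¬(ξ t ω ∈ f i ↔ neighbor sel (fun t => ξ t ω) t ∈ f i)) T := fun i T =>
      measurable_tally_mistake hsel hξ (hf i) T
    refine rate_eq_zero_of_le_newVisits hξ hR (C := C) (fun n => ?_) (fun n m h x hx => ?_) ?_
      (q := fun n T ω => ∑ i ∈ Finset.range n,
        tally (fun t => ¬(ξ t ω ∈ f i ↔ neighbor sel (fun t => ξ t ω) t ∈ f i)) T)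
      (fun n T => Finset.measurable_fun_sum _ fun i _ => hq i T) (fun n => ?_) (fun n T ω => ?_)
    · exact MeasurableSet.iUnion fun i => MeasurableSet.iUnion fun _ => hf i
    · obtain ⟨i, hi, hx⟩ := (hC _).1 hx
      exact (hC _).2 ⟨i, h.trans hi, hx⟩
    · rw [Set.eq_empty_iff_forall_notMem]
      intro x hx
      obtain ⟨i, -, hi⟩ := (hC 0).1 (Set.mem_iInter.1 hx 0)
      obtain ⟨j, hj, hj'⟩ := (hC (i + 1)).1 (Set.mem_iInter.1 hx (i + 1))
      exact Set.disjoint_left.1 (hdisj (show i ≠ j by omega)) hi hj'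
    · refine le_antisymm ((R.rate_finset_sum_le _ hq).trans ?_) bot_le
      exact (Finset.sum_eq_zero fun i _ => ih i).le
    · refine (tally_le_add_newVisits hsel (C := C n) (q := fun t => ∃ i ∈ Finset.range n,
        ¬(ξ t ω ∈ f i ↔ neighbor sel (fun t => ξ t ω) t ∈ f i)) fun t ht => ⟨hmoved ht, ?_⟩).trans ?_
      · by_contra! h
        obtain ⟨h1, h2, h3⟩ := h
        have key : ∀ i, ξ t ω ∈ f i ↔ neighbor sel (fun t => ξ t ω) t ∈ f i := fun i => by
          rcases lt_or_ge i n with hi | hi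
          · exact h1 i (Finset.mem_range.2 hi)
          · exact iff_of_false (fun h => h2 ((hC n).2 ⟨i, hi, h⟩)) fun h => h3 ((hC n).2 ⟨i, hi, h⟩)
        exact ht (by simp only [Set.mem_iUnion, key])
      · gcongr
        exact tally_exists_le _ fun t _ h => h

/-- The rule learns every measurable target under a process with continuous visit rate. -/
theorem rate_cumLoss_kC1NN_eq_zero {R : RateFunctional P} {Y : Type*} [MeasurableSpace Y]
    {loss : Y → Y → ℝ} (hnear : IsNearMetric loss) (hsep : IsSeparableLoss loss)
    (hbdd : IsBoundedLoss loss) (hmeas : Measurable fun p : Y × Y => loss p.1 p.2)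
    (hsel : IsNearestSelector sel) (y₀ : Y) (hξ : ∀ t, Measurable (ξ t))
    (hR : HasContinuousVisitRate R ξ) {g : X → Y} (hg : Measurable g) :
    R.rate (fun T ω => cumLoss loss (kC1NN 2 sel y₀) g (fun t => ξ t ω) T) = 0 := by
  classical
  obtain ⟨M, hM⟩ := hbdd
  obtain ⟨c, hc⟩ := hnear.relaxed_triangle
  obtain ⟨S, hS, hdense⟩ := hsep
  obtain ⟨s, rfl⟩ := hS.exists_eq_range (by
    obtain ⟨s, hs, -⟩ := hdense y₀ 1 one_pos
    exact ⟨s, hs⟩)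
  have hbound : ∀ δ : ℝ, 0 < δ →
      R.rate (fun T ω => cumLoss loss (kC1NN 2 sel y₀) g (fun t => ξ t ω) T)
        ≤ ENNReal.ofReal (|c| * (2 * δ)) := fun δ hδ => by
    have hex : ∀ x, ∃ i, loss (s i) (g x) < δ := fun x => by
      obtain ⟨_, ⟨i, rfl⟩, hi⟩ := hdense (g x) δ hδ
      exact ⟨i, hi⟩
    -- Discretize the target by the first dense value within `δ`. If a point and its neighbour share
    -- this index, the relaxed triangle inequality bounds the loss by `|c| * (2 * δ)`.
    let e : X → ℕ := fun x => Nat.find (hex x)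
    have he : Measurable e := measurable_find hex fun i =>
      measurableSet_lt (hmeas.comp (measurable_const.prodMk hg)) measurable_const
    have hspec : ∀ x, loss (s (e x)) (g x) < δ := fun x => Nat.find_spec (hex x)
    have hD : ∀ i, MeasurableSet (e ⁻¹' {i}) := fun i => he (measurableSet_singleton i)
    let E : ℕ → Ω → ℝ≥0∞ := fun T ω =>
      tally (fun t => e (ξ t ω) ≠ e (neighbor sel (fun t => ξ t ω) t)) T
    have hEmeas : ∀ T, Measurable (E T) := measurable_tally
      (p := fun ω t => e (ξ t ω) ≠ e (neighbor sel (fun t => ξ t ω) t)) fun t =>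
      (measurableSet_eq_fun (he.comp (hξ t)) (he.comp (measurable_neighbor hsel hξ t))).compl
    have hq : ∀ i T, Measurable fun ω => tally (fun t =>
        ¬(ξ t ω ∈ e ⁻¹' {i} ↔ neighbor sel (fun t => ξ t ω) t ∈ e ⁻¹' {i})) T := fun i T =>
      measurable_tally_mistake hsel hξ (hD i) T
    have hE : R.rate E = 0 := by
      refine rate_eq_zero_of_le_newVisits hξ hR (C := fun n => e ⁻¹' Set.Ici n)
        (fun n => he measurableSet_Ici) (fun n m h x hx => le_trans h hx) ?_
        (q := fun n T ω => ∑ i ∈ Finset.range n, tally (fun t =>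
          ¬(ξ t ω ∈ e ⁻¹' {i} ↔ neighbor sel (fun t => ξ t ω) t ∈ e ⁻¹' {i})) T)
        (fun n T => Finset.measurable_fun_sum _ fun i _ => hq i T) (fun n => ?_) (fun n T ω => ?_)
      · rw [Set.eq_empty_iff_forall_notMem]
        intro x hx
        exact absurd (Set.mem_iInter.1 hx (e x + 1)) (not_le.2 (Nat.lt_succ_self _))
      · refine le_antisymm ((R.rate_finset_sum_le _ hq).trans ?_) bot_le
        exact (Finset.sum_eq_zero fun i _ => rate_mistake_eq_zero hsel hξ hR (hD i)).le
      · refine (tally_le_add_newVisits hsel (C := e ⁻¹' Set.Ici n)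
          (q := fun t => ∃ i ∈ Finset.range n,
            ¬(ξ t ω ∈ e ⁻¹' {i} ↔ neighbor sel (fun t => ξ t ω) t ∈ e ⁻¹' {i}))
          fun t ht => ⟨fun h => ht (by rw [h]), ?_⟩).trans ?_
        · rcases lt_or_ge (e (ξ t ω)) n with h | h
          · refine Or.inl ⟨_, Finset.mem_range.2 h, fun h' => ht ?_⟩
            exact (h'.1 rfl).symm
          · exact Or.inr (Or.inl h)
        · gcongr
          exact tally_exists_le _ fun t _ h => h
    -- The first constant pays for the blind prediction at time `0`.
    have hle : ∀ T ω, cumLoss loss (kC1NN 2 sel y₀) g (fun t => ξ t ω) T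
        ≤ ENNReal.ofReal M + ENNReal.ofReal (|c| * (2 * δ)) * T + ENNReal.ofReal M * E T ω := by
      intro T ω
      obtain _ | T := T
      · simp [cumLoss]
      simp only [cumLoss, E, tally, Finset.sum_range_succ' (n := T)]
      have h0 : ENNReal.ofReal (loss (kC1NN 2 sel y₀ 0 (fun i : Fin 0 => ξ i ω)
          (fun i : Fin 0 => g (ξ i ω)) (ξ 0 ω)) (g (ξ 0 ω))) ≤ ENNReal.ofReal M :=
        ENNReal.ofReal_le_ofReal (hM _ _)
      have hstep : ∀ t, ENNReal.ofReal (loss (kC1NN 2 sel y₀ (t + 1)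
          (fun i : Fin (t + 1) => ξ i ω) (fun i : Fin (t + 1) => g (ξ i ω)) (ξ (t + 1) ω))
            (g (ξ (t + 1) ω)))
          ≤ ENNReal.ofReal (|c| * (2 * δ)) + ENNReal.ofReal M * (if e (ξ (t + 1) ω)
            ≠ e (neighbor sel (fun t => ξ t ω) (t + 1)) then 1 else 0) := fun t => by
        rw [kC1NN_succ]
        change ENNReal.ofReal (loss (g (neighbor sel (fun t => ξ t ω) (t + 1))) _) ≤ _
        generalize neighbor sel (fun t => ξ t ω) (t + 1) = z
        split_ifs with h
        · rw [mul_one]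
          exact (ENNReal.ofReal_le_ofReal (hM _ _)).trans le_add_self
        · rw [mul_zero, add_zero]
          refine ENNReal.ofReal_le_ofReal ((hc _ (s (e z)) _).trans ?_)
          have h1 := hspec z
          have h2 := hspec (ξ (t + 1) ω)
          rw [not_not.1 h] at h2
          have h3 := hnear.nonneg (s (e z)) (g z)
          have h4 := hnear.nonneg (s (e z)) (g (ξ (t + 1) ω))
          exact mul_le_mul (le_abs_self c) (by linarith) (by linarith) (abs_nonneg c)
      calc _ ≤ ∑ t ∈ Finset.range T, (ENNReal.ofReal (|c| * (2 * δ)) + ENNReal.ofReal M *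
            (if e (ξ (t + 1) ω) ≠ e (neighbor sel (fun t => ξ t ω) (t + 1)) then 1 else 0))
              + ENNReal.ofReal M := add_le_add (Finset.sum_le_sum fun t _ => hstep t) h0
        _ = ENNReal.ofReal M + ENNReal.ofReal (|c| * (2 * δ)) * T + ENNReal.ofReal M *
            ∑ t ∈ Finset.range T,
              (if e (ξ (t + 1) ω) ≠ e (neighbor sel (fun t => ξ t ω) (t + 1)) then 1 else 0) := by
            rw [Finset.sum_add_distrib, ← Finset.mul_sum, Finset.sum_const, Finset.card_range,
              nsmul_eq_mul]
            ring
        _ ≤ _ := by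
            push_cast
            gcongr
            · exact le_self_add
            · refine le_trans (le_of_eq ?_) le_self_add
              congr!
    calc _ ≤ _ := R.rate_mono hle
      _ ≤ _ := R.rate_add_le fun T => measurable_const
      _ ≤ (0 + ENNReal.ofReal (|c| * (2 * δ)) * 1) + ENNReal.ofReal M * 0 := by
          refine add_le_add ((R.rate_add_le fun T => measurable_const).trans (add_le_add
            (R.rate_const ENNReal.ofReal_ne_top).le ?_)) ?_
          · exact (R.rate_const_mul_le ENNReal.ofReal_ne_top fun T => measurable_const).trans
              (by gcongr; exact R.rate_time_le)
          · exact (R.rate_const_mul_le ENNReal.ofReal_ne_top hEmeas).trans (by rw [hE])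
      _ = _ := by simp
  have hlim : Tendsto (fun δ : ℝ => ENNReal.ofReal (|c| * (2 * δ))) (𝓝[>] 0) (𝓝 0) := by
    have h : Continuous fun δ : ℝ => ENNReal.ofReal (|c| * (2 * δ)) :=
      ENNReal.continuous_ofReal.comp (by fun_prop)
    have := (h.tendsto 0).mono_left (nhdsWithin_le_nhds (s := Set.Ioi 0))
    simpa using this
  exact le_antisymm (ge_of_tendsto hlim (eventually_mem_nhdsWithin.mono hbound)) bot_le

end Sufficiency

/-! ### Consistency in terms of rate functionals -/

theorem iInf_iSup_add_eq_zero_iff {u : ℕ → ℝ≥0∞} :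
    ⨅ a, ⨆ k, u (a + k) = 0 ↔ Tendsto u atTop (𝓝 0) := by
  constructor
  · intro h
    have hanti : Antitone fun a => ⨆ k, u (a + k) := fun a b hab => iSup_le fun k =>
      le_iSup_of_le (b - a + k) (by rw [show a + (b - a + k) = b + k by omega])
    have := tendsto_atTop_iInf hanti
    rw [h] at this
    exact tendsto_of_tendsto_of_tendsto_of_le_of_le tendsto_const_nhds this (fun _ => zero_le)
      fun a => le_iSup (fun k => u (a + k)) 0
  · intro h
    refine le_antisymm (le_of_forall_gt_imp_ge_of_dense fun δ hδ => ?_) bot_le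
    obtain ⟨N, hN⟩ := ENNReal.tendsto_atTop_zero.1 h δ hδ
    exact iInf_le_of_le N (iSup_le fun k => hN _ (Nat.le_add_right _ _))

section Conversion

variable {X Y Ω : Type*} {loss : Y → Y → ℝ}

theorem avgLoss_nonneg (h0 : ∀ y₁ y₂, 0 ≤ loss y₁ y₂) (f : Rule X Y) (g : X → Y) (x : ℕ → X)
    (T : ℕ) : 0 ≤ avgLoss loss f g x T :=
  div_nonneg (Finset.sum_nonneg fun _ _ => h0 _ _) (Nat.cast_nonneg _)

theorem ofReal_avgLoss (h0 : ∀ y₁ y₂, 0 ≤ loss y₁ y₂) (f : Rule X Y) (g : X → Y) (x : ℕ → X)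
    (T : ℕ) : ENNReal.ofReal (avgLoss loss f g x T) = cumLoss loss f g x T / T := by
  obtain _ | T := T
  · simp [avgLoss, cumLoss]
  · rw [avgLoss, cumLoss, ENNReal.ofReal_div_of_pos (by positivity),
      ENNReal.ofReal_sum_of_nonneg fun _ _ => h0 _ _, ENNReal.ofReal_natCast]

theorem tendsto_iff_tendsto_ofReal {u : ℕ → ℝ} (hu : ∀ n, 0 ≤ u n) :
    Tendsto u atTop (𝓝 0) ↔ Tendsto (fun n => ENNReal.ofReal (u n)) atTop (𝓝 0) := by
  constructor
  · intro h
    simpa using ENNReal.tendsto_ofReal h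
  · intro h
    have := (ENNReal.tendsto_toReal ENNReal.zero_ne_top).comp h
    simpa [Function.comp_def, ENNReal.toReal_ofReal (hu _)] using this

variable [MeasurableSpace X] [MeasurableSpace Y] [MeasurableSpace Ω] {P : Measure Ω}
  [IsProbabilityMeasure P] {ξ : ℕ → Ω → X} {f : Rule X Y}

theorem measurable_cumLoss (hmeas : Measurable fun p : Y × Y => loss p.1 p.2)
    (hf : IsLearningRule f) (hξ : ∀ t, Measurable (ξ t)) {g : X → Y} (hg : Measurable g) (T : ℕ) :
    Measurable fun ω => cumLoss loss f g (fun t => ξ t ω) T :=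
  measurable_cumLoss_of_measurable hmeas hf (g := fun _ => g) (x := fun ω t => ξ t ω)
    (hg.comp measurable_snd) hξ T

theorem stronglyUniversallyConsistent_iff (h0 : ∀ y₁ y₂, 0 ≤ loss y₁ y₂) (hbdd : IsBoundedLoss loss)
    (hmeas : Measurable fun p : Y × Y => loss p.1 p.2) (hf : IsLearningRule f)
    (hξ : ∀ t, Measurable (ξ t)) :
    StronglyUniversallyConsistent loss P ξ f ↔ ∀ g, Measurable g →
      (strongRate P).rate (fun T ω => cumLoss loss f g (fun t => ξ t ω) T) = 0 := by
  obtain ⟨M, hM⟩ := hbdd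
  refine forall₂_congr fun g hg => ?_
  simp only [tendsto_iff_tendsto_ofReal (avgLoss_nonneg h0 f g _), ofReal_avgLoss h0]
  let r : ℕ → Ω → ℝ≥0∞ := fun T ω => cumLoss loss f g (fun t => ξ t ω) T / T
  have hr : ∀ T, Measurable (r T) := fun T => (measurable_cumLoss hmeas hf hξ hg T).div_const _
  have hsup : ∀ a, Measurable fun ω => ⨆ k, r (a + k) ω := fun a => Measurable.iSup fun k => hr _
  change (∀ᵐ ω ∂P, Tendsto (fun T => r T ω) atTop (𝓝 0)) ↔ ⨅ a, ∫⁻ ω, ⨆ k, r (a + k) ω ∂P = 0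
  have hanti : ∀ ω, Antitone fun a => ⨆ k, r (a + k) ω := fun ω a b hab => iSup_le fun k =>
    le_iSup_of_le (b - a + k) (by rw [show a + (b - a + k) = b + k by omega])
  have hbound : ∀ a ω, ⨆ k, r (a + k) ω ≤ ENNReal.ofReal M := fun a ω => iSup_le fun k =>
    (ENNReal.div_le_div_right (cumLoss_le hM f g _ _) _).trans (by
      rw [mul_div_assoc]
      exact mul_le_of_le_one_right' ENNReal.div_self_le_one)
  -- Boundedness of the loss makes the decreasing integrands integrable, so the infimum passes
  -- inside, where it is the limsup of the frequencies.
  have hinf : ⨅ a, ∫⁻ ω, ⨆ k, r (a + k) ω ∂P = ∫⁻ ω, ⨅ a, ⨆ k, r (a + k) ω ∂P := by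
    rw [lintegral_iInf hsup (fun a b hab ω => hanti ω hab)]
    exact ((lintegral_mono (hbound 0)).trans_lt (by simp)).ne
  rw [hinf, lintegral_eq_zero_iff (Measurable.iInf hsup)]
  refine eventually_congr (Eventually.of_forall fun ω => ?_)
  exact (iInf_iSup_add_eq_zero_iff (u := fun T => r T ω)).symm

theorem weaklyUniversallyConsistent_iff (h0 : ∀ y₁ y₂, 0 ≤ loss y₁ y₂) (hbdd : IsBoundedLoss loss)
    (hmeas : Measurable fun p : Y × Y => loss p.1 p.2) (hf : IsLearningRule f)
    (hξ : ∀ t, Measurable (ξ t)) :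
    WeaklyUniversallyConsistent loss P ξ f ↔ ∀ g, Measurable g →
      (weakRate P).rate (fun T ω => cumLoss loss f g (fun t => ξ t ω) T) = 0 := by
  obtain ⟨M, hM⟩ := hbdd
  refine forall₂_congr fun g hg => ?_
  have hcum := measurable_cumLoss hmeas hf hξ hg
  have hle : ∀ T ω, ENNReal.ofReal (avgLoss loss f g (fun t => ξ t ω) T) ≤ ENNReal.ofReal M :=
    fun T ω => by
      rw [ofReal_avgLoss h0]
      refine (ENNReal.div_le_div_right (cumLoss_le hM f g _ _) _).trans ?_
      rw [mul_div_assoc]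
      exact mul_le_of_le_one_right' ENNReal.div_self_le_one
  have havg : ∀ T, Measurable fun ω => avgLoss loss f g (fun t => ξ t ω) T := fun T => by
    have h : ∀ ω, avgLoss loss f g (fun t => ξ t ω) T
        = (cumLoss loss f g (fun t => ξ t ω) T / T).toReal := fun ω => by
      rw [← ofReal_avgLoss h0, ENNReal.toReal_ofReal (avgLoss_nonneg h0 f g _ T)]
    simp only [h]
    exact ((hcum T).div_const _).ennreal_toReal
  have hint : ∀ T, Integrable (fun ω => avgLoss loss f g (fun t => ξ t ω) T) P := fun T => by
    refine ⟨(havg T).aestronglyMeasurable, ?_⟩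
    rw [hasFiniteIntegral_iff_ofReal (Eventually.of_forall fun ω => avgLoss_nonneg h0 f g _ T)]
    exact (lintegral_mono (hle T)).trans_lt (by simp)
  have e : ∀ T : ℕ, ENNReal.ofReal (∫ ω, avgLoss loss f g (fun t => ξ t ω) T ∂P)
      = (∫⁻ ω, cumLoss loss f g (fun t => ξ t ω) T ∂P) / T := fun T => by
    rw [ofReal_integral_eq_lintegral_ofReal (hint T)
      (Eventually.of_forall fun ω => avgLoss_nonneg h0 f g _ T)]
    simp only [ofReal_avgLoss h0, div_eq_mul_inv]
    exact lintegral_mul_const _ (hcum T)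
  rw [tendsto_iff_tendsto_ofReal fun T => integral_nonneg fun ω => avgLoss_nonneg h0 f g _ T]
  simp only [e]
  exact iInf_iSup_add_eq_zero_iff.symm

end Conversion

/-- If some rule learns every measurable target under a process, then so does the capped nearest
neighbour rule. -/
theorem rate_cumLoss_kC1NN_eq_zero_of_rule {X : Type*} [MetricSpace X]
    [TopologicalSpace.SeparableSpace X] [MeasurableSpace X] [BorelSpace X] {Y : Type*}
    [MeasurableSpace Y] {loss : Y → Y → ℝ} (hnear : IsNearMetric loss)
    (hsep : IsSeparableLoss loss) (hbdd : IsBoundedLoss loss)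
    (hmeas : Measurable fun p : Y × Y => loss p.1 p.2) {sel : Selector X}
    (hsel : IsNearestSelector sel) (y₀ : Y) {Ω : Type*} [MeasurableSpace Ω] {P : Measure Ω}
    [IsProbabilityMeasure P] (R : RateFunctional P) {ξ : ℕ → Ω → X} (hξ : ∀ t, Measurable (ξ t))
    {f : Rule X Y} (hf : IsLearningRule f)
    (hcons : ∀ g, Measurable g → R.rate (fun T ω => cumLoss loss f g (fun t => ξ t ω) T) = 0)
    {g : X → Y} (hg : Measurable g) :
    R.rate (fun T ω => cumLoss loss (kC1NN 2 sel y₀) g (fun t => ξ t ω) T) = 0 := by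
  -- With a single value there is nothing to predict, and no two labels for the coin argument.
  by_cases hY : ∀ y, y = y₀
  · have h : ∀ y₁ y₂, loss y₁ y₂ = 0 := fun y₁ y₂ =>
      (hnear.eq_zero_iff _ _).2 ((hY y₁).trans (hY y₂).symm)
    simpa [cumLoss, h] using R.rate_const (c := 0) (by simp)
  push Not at hY
  obtain ⟨y₁, hy₁⟩ := hY
  refine rate_cumLoss_kC1NN_eq_zero hnear hsep hbdd hmeas hsel y₀ hξ ?_ hg
  obtain ⟨M, hM⟩ := hbdd
  obtain ⟨c, hc⟩ := hnear.relaxed_triangle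
  have hpos : 0 < loss y₁ y₀ := (hnear.nonneg _ _).lt_of_ne' fun h =>
    hy₁ ((hnear.eq_zero_iff _ _).1 h)
  -- No prediction is close to both labels; `|c| + 1` gives a positive denominator whatever the sign
  -- of `c`.
  have hκ : ∀ y', loss y₁ y₀ / (|c| + 1) ≤ loss y' y₁ + loss y' y₀ := fun y' => by
    rw [div_le_iff₀ (by positivity), mul_comm]
    refine (hc y₁ y' y₀).trans ?_
    have := add_nonneg (hnear.nonneg y' y₁) (hnear.nonneg y' y₀)
    gcongr
    linarith [le_abs_self c]
  intro C hC hanti hempty ε hε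
  refine exists_rate_newVisits_le R hξ (fun c' hc' => ?_) hC hanti hempty hε
  refine rate_visits_eq_zero R hM hmeas (fun b => if b then y₁ else y₀)
    (κ := ENNReal.ofReal (loss y₁ y₀ / (|c| + 1))) ?_ (fun y' => ?_) hξ hf hcons hc'
  · exact (ENNReal.ofReal_pos.2 (by positivity)).ne'
  · rw [← ENNReal.ofReal_add (hnear.nonneg _ _) (hnear.nonneg _ _)]
    exact ENNReal.ofReal_le_ofReal (by simpa using hκ y')

end OnlineLearning

theorem theorem2
    {X : Type*} [MetricSpace X] [TopologicalSpace.SeparableSpace X]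
    [MeasurableSpace X] [BorelSpace X]
    {Y : Type*} [MeasurableSpace Y] (loss : Y → Y → ℝ)
    (hnear : OnlineLearning.IsNearMetric loss)
    (hsep : OnlineLearning.IsSeparableLoss loss)
    (hbdd : OnlineLearning.IsBoundedLoss loss)
    (hmeas : Measurable fun p : Y × Y => loss p.1 p.2)
    (sel : OnlineLearning.Selector X) (hsel : OnlineLearning.IsNearestSelector sel) (y₀ : Y) :
    OnlineLearning.StronglyOptimisticallyUniversal loss (OnlineLearning.kC1NN 2 sel y₀) ∧
      OnlineLearning.WeaklyOptimisticallyUniversal loss (OnlineLearning.kC1NN 2 sel y₀) := by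
  have hrule := OnlineLearning.isLearningRule_kC1NN hsel y₀
  refine ⟨⟨hrule, fun Ω _ P _ ξ hξ => ?_⟩, ⟨hrule, fun Ω _ P _ ξ hξ => ?_⟩⟩
  · obtain ⟨hξm, f, hf, hcons⟩ := hξ
    rw [OnlineLearning.stronglyUniversallyConsistent_iff hnear.nonneg hbdd hmeas hf hξm] at hcons
    rw [OnlineLearning.stronglyUniversallyConsistent_iff hnear.nonneg hbdd hmeas hrule hξm]
    exact fun g hg => OnlineLearning.rate_cumLoss_kC1NN_eq_zero_of_rule hnear hsep hbdd hmeas hsel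
      y₀ _ hξm hf hcons hg
  · obtain ⟨hξm, f, hf, hcons⟩ := hξ
    rw [OnlineLearning.weaklyUniversallyConsistent_iff hnear.nonneg hbdd hmeas hf hξm] at hcons
    rw [OnlineLearning.weaklyUniversallyConsistent_iff hnear.nonneg hbdd hmeas hrule hξm]
    exact fun g hg => OnlineLearning.rate_cumLoss_kC1NN_eq_zero_of_rule hnear hsep hbdd hmeas hsel
      y₀ _ hξm hf hcons hg
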